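/- **Setting.** Let $X$ be a finite state space; for $x\in X$ let $U(x)\neq\emptyset$ be the finite set of allowed actions and $L(x)\subseteq 2^{AP}$ the finite set of possible labels; let $D=\{(x,u): u\in U(x)\}$, let $c_D:D\to\mathbb R^{>0}$ be the cost, and let $x_0\in X$, $l_0\in L(x_0)$ be initial. The transition probabilities $p_D(x,u,\cdot)$, $(x,u)\in D$, and the label probabilities $p_L(x,\cdot)$ on $L(x)$, $x\in X$, are unknown; under the belief $\boldsymbol\alpha$ they are independent Dirichlet vectors with non-negative parameters $\alpha_x^u(\check x)$ and $\alpha_x^L(l)$ (for each vector not all zero). A draw of $(p_D,p_L)$ is a sample $\mathcal M$. Let $\mathcal A=(Q,2^{AP},\delta,q_0,\mathrm{Acc})$ be a deterministic Rabin automaton with finite $Q$; a pair $(H,I)\in\mathrm{Acc}$ asks for finitely many visits to $H$ and infinitely many to $I$. The product $\mathcal P$ of $\mathcal M$ and $\mathcal A$ has states $S=\{\langle x,l,q\rangle: l\in L(x)\}$, initial state $s_0=\langle x_0,l_0,q_0\rangle$, actions $U(\langle x,l,q\rangle)=U(x)$, and $p_E(\langle x,l,q\rangle,u,\langle\check x,\check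 l,\check q\rangle)=p_D(x,u,\check x)\,p_L(\check x,\check l)$ if $\check q=\delta(q,l)$, and $0$ otherwise. $\overline{\mathcal P}$ has transition probabilities $\bar p=\mathbb E_{\boldsymbol\alpha}\{p_E\}$. Let $\mathcal K_s^u$ be the set of successors $\check s=\langle\check x,\check l,\check q\rangle$ of $(s,u)$, $s=\langle x,l,q\rangle$, with $\check q=\delta(q,l)$, $\alpha_x^u(\check x)>0$, $\alpha_{\check x}^L(\check l)>0$ (almost surely those with $p_E(s,u,\check s)>0$). Let $S_\Xi$ be the union of the accepting maximal end components, i.e. of the end components $(C,B)$ of the graph $(\mathcal K_s^u)$ that, for some accepting pair $(H,I)$, have no state with $q\in H$ and some state with $q\in I$, and are maximal with this property. For a set $X_{\mathtt r}\subseteq X$ of home states let $S_{\mathtt r}=\{\langle x,l,q\rangle\in S: x\in X_{\mathtt r}\}$. Let $\overline{\mathcal P}_1$ and $\overline{\mathcal P}_2$ have the (sub-stochastic) transition measures $(1-\mathbf 1_{s\in S_\Xi})\,\bar p$ and $(1-\mathbf 1_{s\in S_{\mathtt r}})\,\bar p$; runs terminate where mass is missing. Policies are randomized and may depend on the history. Put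 $$\sigma_{s,u}=\sum_{\check s\in\mathcal K_s^u}\mathbb E_{\boldsymbol\alpha}\{\min(0,\,p_E(s,u,\check s)-\bar p(s,u,\check s))\},$$ $c_E(\langle x,l,q\rangle,u)=c_D(x,u)$, and, with constants $g_U,g_L,\alpha_U,\alpha_L>0$, let the exploration bonus $\xi_s^u$, for $s=\langle x,l,q\rangle$, be $0$ if $a>\alpha_U$ and $a'>\alpha_L$, and $\frac{g_U}{1+a}+\frac{g_L}{1+a'}$ otherwise, where $a=\sum_{\check x}\alpha_x^u(\check x)$ and $a'=\sum_{\check x:\,\alpha_x^u(\check x)>0}\sum_{l\in L(\check x)}\alpha_{\check x}^L(l)$. For a return policy $\pi_{\mathtt r}$ let $$v_s=\mathbb E_{\overline{\mathcal P}_2}^{s,\pi_{\mathtt r}}\Big\{\sum_{t\ge0}\big(\mathbf 1_{s_t\in S_{\mathtt r}}+(1-\mathbf 1_{s_t\in S_{\mathtt r}})\,\sigma_{s_t,u_t}\big)\Big\}\in[-\infty,1].$$ Expected infinite sums are read in $[-\infty,\infty]$ as upper limits of the expected sums over finite horizons. Let $\chi_{\mathtt o},\chi_{\mathtt r}>0$.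 **Prefix problem.** Minimize $\mathbb E_{\overline{\mathcal P}_1}^{s_0,\pi_{\mathtt o}}\{\sum_{t\ge0}(c_E(s_t,u_t)-\xi_{s_t}^{u_t})\}$ over the pairs $(\pi_{\mathtt o},\pi_{\mathtt r})$ with $$\mathbb E_{\overline{\mathcal P}_1}^{s_0,\pi_{\mathtt o}}\Big\{\sum_{t\ge0}(\mathbf 1_{s_t\in S_\Xi}+\sigma_{s_t,u_t})\Big\}\ge\chi_{\mathtt o},\qquad \mathbb E_{\overline{\mathcal P}_1}^{s_0,\pi_{\mathtt o}}\{v_{s_1}+\sigma_{s_0,u_0}\}\ge\chi_{\mathtt r}.$$ **Its linear program**, for given $v$. With $\bar p_1$ the transition measure of $\overline{\mathcal P}_1$, minimize $\sum_{s,u}y_{s,u}(c_E(s,u)-\xi_s^u)$ over $y\ge0$ subject to $\sum_u y_{\check s,u}=\mathbf 1_{\check s=s_0}+\sum_{s,u}y_{s,u}\,\bar p_1(s,u,\check s)$ for all $\check s\in S$, $\ \sum_{s,u}y_{s,u}(\mathbf 1_{s\in S_\Xi}+\sigma_{s,u})\ge\chi_{\mathtt o}$, and $\sum_u y_{s_0,u}\big(\sum_{\check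 s}\bar p_1(s_0,u,\check s)v_{\check s}+\sigma_{s_0,u}\big)\ge\chi_{\mathtt r}\sum_u y_{s_0,u}$. A policy derived from $y$ is a stationary policy that takes $u$ at $s$ with probability $y_{s,u}/\sum_w y_{s,w}$ whenever this denominator is positive. **Lemma 1.** Let $\pi_{\mathtt o},\pi_{\mathtt r}$ be policies such that either $(\pi_{\mathtt o},\pi_{\mathtt r})$ is an optimal solution of the prefix problem, or $\pi_{\mathtt o}$ is derived from an optimal solution of the linear program for the values $v$ of $\pi_{\mathtt r}$. Then, under the belief, the probability of reaching the accepting maximal end components is at least $\chi_{\mathtt o}$ and the expected safe-return probability is at least $\chi_{\mathtt r}$: $$\mathbb E_{\boldsymbol\alpha}\big\{\mathrm{Pr}_{\mathcal P}^{s_0,\pi_{\mathtt o}}(\Diamond S_\Xi)\big\}\ge\chi_{\mathtt o},\qquad \mathbb E_{\boldsymbol\alpha}\big\{\mathbb E_{\mathcal P}^{s_0,\pi_{\mathtt o}}\,\mathrm{Pr}_{\mathcal P}^{s_1,\pi_{\mathtt r}}(\Diamond S_{\mathtt r})\big\}\ge\chi_{\mathtt r}.$$ -/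

import Mathlib

open MeasureTheory ProbabilityTheory
open scoped ENNReal NNReal

noncomputable section

namespace SafePlan

/-! ### Finite Markov decision processes, policies, runs -/

section MDP

/-- A state together with an action allowed there. -/
abbrev Edge {S : Type*} (A : S → Type*) : Type _ := Σ s, A s

/-- A step of a run: a state-action pair, or `none` once the run has been terminated. -/
def Step {S : Type*} (A : S → Type*) : Type _ := Option (Edge A)

instance {S : Type*} (A : S → Type*) : MeasurableSpace (Step A) := ⊤

instance {S : Type*} (A : S → Type*) : DiscreteMeasurableSpace (Step A) := ⟨fun _ => trivial⟩

instance {S : Type*} [Finite S] (A : S → Type*) [∀ s, Finite (A s)] : Finite (Step A) :=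
  inferInstanceAs (Finite (Option (Edge A)))

/-- A randomized history-dependent policy: given the past state-action pairs (oldest first) and
the current state, a distribution over the actions allowed there. -/
abbrev Policy {S : Type*} (A : S → Type*) : Type _ := List (Edge A) → (s : S) → PMF (A s)

/-- A transition measure. A sub-stochastic one is represented by sending the missing mass to
`none`, where the run terminates. -/
abbrev Trans {S : Type*} (A : S → Type*) : Type _ := (s : S) → A s → PMF (Option S)

/-- A stochastic transition measure, seen as one that never terminates. -/
def full {S : Type*} {A : S → Type*} (P : (s : S) → A s → PMF S) : Trans A :=
  fun s u => (P s u).map some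

open Classical in
/-- The transition measure `(1 - 1_{s ∈ G}) • P`. -/
def killed {S : Type*} {A : S → Type*} (G : Set S) (P : (s : S) → A s → PMF S) : Trans A :=
  fun s u => if s ∈ G then PMF.pure none else (P s u).map some

/-- Law of the next step, given all past state-action pairs `h` (the last one included) and the
last step. -/
def nextLaw {S : Type*} {A : S → Type*} (T : Trans A) (π : Policy A) (h : List (Edge A)) :
    Step A → PMF (Step A)
  | none => PMF.pure none
  | some e => (T e.1 e.2).bind fun
      | none => PMF.pure none
      | some s' => (π h s').map fun u' => some ⟨s', u'⟩

/-- The list of state-action pairs of a finite run, oldest first. -/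
def past {S : Type*} {A : S → Type*} (n : ℕ) (r : (i : Finset.Iic n) → Step A) :
    List (Edge A) :=
  List.reduceOption
    ((List.finRange (n + 1)).map fun i : Fin (n + 1) =>
      r ⟨i, Finset.mem_Iic.2 (Nat.lt_succ_iff.1 i.isLt)⟩)

variable {S : Type*} [Finite S] {A : S → Type*} [∀ s, Finite (A s)]

/-- The law of step `n + 1` given steps `0, …, n`, as a Markov kernel. -/
def stepKernel (T : Trans A) (π : Policy A) (n : ℕ) :
    Kernel ((_ : Finset.Iic n) → Step A) (Step A) where
  toFun r := (nextLaw T π (past n r) (r ⟨n, Finset.mem_Iic.2 le_rfl⟩)).toMeasure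
  measurable' := measurable_of_countable _

instance (T : Trans A) (π : Policy A) (n : ℕ) : IsMarkovKernel (stepKernel T π n) :=
  ⟨fun r => by
    change IsProbabilityMeasure (PMF.toMeasure _)
    infer_instance⟩

/-- Law of step `0` from state `s`. -/
def initLaw (π : Policy A) (s : S) : PMF (Step A) := (π [] s).map fun u => some ⟨s, u⟩

/-- The probability measure on infinite runs started at `s` under the policy `π`. -/
def runLaw (T : Trans A) (π : Policy A) (s : S) : Measure (ℕ → Step A) :=
  Kernel.trajMeasure (X := fun _ => Step A) (initLaw π s).toMeasure (stepKernel T π)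

/-- `Pr^{s, π}(◇ G)`: the probability that a run from `s` visits `G` at some time `t ≥ 0`. -/
def reachProb (T : Trans A) (π : Policy A) (s : S) (G : Set S) : ℝ≥0∞ :=
  runLaw T π s {r | ∃ t, ∃ e : Edge A, r t = some e ∧ e.1 ∈ G}

/-- The value of `f` at a step; terminated runs contribute zero. -/
def stepVal (f : Edge A → ℝ) (z : Step A) : ℝ := Option.elim z 0 f

/-- The expected total value `E^{s, π} {∑_{t ≥ 0} f (s_t, u_t)}`, in `[-∞, ∞]`: the upper limit of
the expected totals over finite horizons, which is the limit whenever that exists. -/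
def expTotal (T : Trans A) (π : Policy A) (s : S) (f : Edge A → ℝ) : EReal :=
  Filter.limsup (fun N : ℕ =>
    ((∫ r, ∑ t ∈ Finset.range N, stepVal f (r t) ∂(runLaw T π s) : ℝ) : EReal)) Filter.atTop

/-- `E^{s, π} {v (s_1) + f (s_0, u_0)}` for the finitely many values of `(u_0, s_1)`. -/
def expFirst {S : Type*} [Fintype S] {A : S → Type*} [∀ s, Fintype (A s)]
    (T : Trans A) (π : Policy A) (s : S) (v : S → EReal) (f : Edge A → ℝ) : EReal :=
  ∑ u : A s, ((π [] s u : ℝ≥0∞) : EReal) *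
    ((∑ s' : S, ((T s u (some s') : ℝ≥0∞) : EReal) * v s') + ((f ⟨s, u⟩ : ℝ) : EReal))

end MDP

/-! ### End components -/

section EndComponents

variable {S : Type*} {A : S → Type*}

/-- `(C, B)` is an end component of the graph `post`: nonempty, closed under its nonempty action
sets, strongly connected. `B` is empty outside `C`. -/
structure IsEndComponent (post : (s : S) → A s → Set S) (C : Set S) (B : (s : S) → Set (A s)) :
    Prop where
  nonempty : C.Nonempty
  action_nonempty : ∀ s ∈ C, (B s).Nonempty
  action_empty : ∀ s, s ∉ C → B s = ∅
  closed : ∀ s ∈ C, ∀ u ∈ B s, post s u ⊆ C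
  connected : ∀ s ∈ C, ∀ s' ∈ C,
    Relation.ReflTransGen (fun a b => ∃ u ∈ B a, b ∈ post a u) s s'

/-- `(C, B)` is an end component that avoids `H` and meets `I`. -/
def IsAcceptingEC (post : (s : S) → A s → Set S) (H I : Set S) (C : Set S)
    (B : (s : S) → Set (A s)) : Prop :=
  IsEndComponent post C B ∧ C ∩ H = ∅ ∧ (C ∩ I).Nonempty

/-- Accepting maximal end component for the pair `(H, I)`: maximal among the accepting ones. -/
def IsAMEC (post : (s : S) → A s → Set S) (H I : Set S) (C : Set S)
    (B : (s : S) → Set (A s)) : Prop :=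
  IsAcceptingEC post H I C B ∧
    ∀ C' B', IsAcceptingEC post H I C' B' → C ⊆ C' → (∀ s, B s ⊆ B' s) →
      C' = C ∧ ∀ s, B' s = B s

end EndComponents

/-! ### The Dirichlet distribution -/

section Dirichlet

/-- The Gamma distribution of shape `a` and rate `1`; the point mass at `0` if `a = 0`. -/
def gammaZ (a : ℝ≥0) : Measure ℝ := if a = 0 then Measure.dirac 0 else gammaMeasure a 1

instance (a : ℝ≥0) : IsProbabilityMeasure (gammaZ a) := by
  unfold gammaZ
  split_ifs with h
  · infer_instance
  · exact isProbabilityMeasure_gammaMeasure (by positivity) one_pos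

lemma gammaZ_nonneg (a : ℝ≥0) : ∀ᵐ x ∂(gammaZ a), 0 ≤ x := by
  unfold gammaZ
  split_ifs with h
  · simp [ae_dirac_eq]
  · rw [ae_iff, gammaMeasure]
    simp only [not_le]
    rw [show {x : ℝ | x < 0} = Set.Iio 0 from rfl, withDensity_apply _ measurableSet_Iio]
    exact lintegral_gammaPDF_of_nonpos le_rfl

lemma gammaZ_ne_zero {a : ℝ≥0} (h : 0 < a) : ∀ᵐ x ∂(gammaZ a), x ≠ 0 := by
  unfold gammaZ
  rw [if_neg h.ne', ae_iff, gammaMeasure]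
  simp only [ne_eq, not_not]
  exact withDensity_absolutelyContinuous _ _ (by simp)

variable {ι : Type*} [Fintype ι]

/-- The Dirichlet distribution with non-negative parameters `α`, not all zero: the law of
`g / ∑ g` for independent `g i` with law `Gamma (α i, 1)`, on the probability simplex. -/
def dirichlet (α : ι → ℝ≥0) : Measure (stdSimplex ℝ ι) :=
  ((Measure.pi fun i => gammaZ (α i)).map fun g i => g i / ∑ j, g j).comap Subtype.val

lemma isProbabilityMeasure_dirichlet {α : ι → ℝ≥0} (h : ∃ i, 0 < α i) :
    IsProbabilityMeasure (dirichlet α) := by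
  have hm : Measurable fun (g : ι → ℝ) i => g i / ∑ j, g j := by fun_prop
  have hs : MeasurableSet (stdSimplex ℝ ι) := (isClosed_stdSimplex ℝ ι).measurableSet
  constructor
  rw [dirichlet, (MeasurableEmbedding.subtype_coe hs).comap_apply, Set.image_univ,
    Subtype.range_coe, Measure.map_apply hm hs, prob_compl_eq_zero_iff (hm hs) |>.symm]
  obtain ⟨k, hk⟩ := h
  have h1 : ∀ᵐ g ∂(Measure.pi fun i => gammaZ (α i)), ∀ i, 0 ≤ g i :=
    ae_all_iff.2 fun i =>
      (Measure.quasiMeasurePreserving_eval (fun i => gammaZ (α i)) i).ae (gammaZ_nonneg (α i))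
  have h2 : ∀ᵐ g ∂(Measure.pi fun i => gammaZ (α i)), g k ≠ 0 :=
    (Measure.quasiMeasurePreserving_eval (fun i => gammaZ (α i)) k).ae (gammaZ_ne_zero hk)
  have h3 : ∀ᵐ g ∂(Measure.pi fun i => gammaZ (α i)),
      g ∈ (fun (g : ι → ℝ) i => g i / ∑ j, g j) ⁻¹' stdSimplex ℝ ι := by
    filter_upwards [h1, h2] with g hg hgk
    have hpos : 0 < ∑ j, g j :=
      Finset.sum_pos' (fun i _ => hg i) ⟨k, Finset.mem_univ _, lt_of_le_of_ne (hg k) hgk.symm⟩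
    refine ⟨fun i => div_nonneg (hg i) hpos.le, ?_⟩
    rw [← Finset.sum_div, div_self hpos.ne']
  exact h3

end Dirichlet

/-! ### The uncertain labelled MDP, the automaton and their product -/

/-- Deterministic Rabin automaton over the alphabet `2^AP`; a pair `(H, I)` asks for finitely many
visits to `H` and infinitely many to `I`. -/
structure DRA (AP Q : Type*) where
  /-- transition function -/
  δ : Q → Set AP → Q
  /-- initial state -/
  init : Q
  /-- accepting pairs -/
  acc : Set (Set Q × Set Q)

/-- A probabilistically labelled MDP together with a belief: Dirichlet parameters for the
transitions of every state-action pair and for the labels of every state. -/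
structure UncertainMDP (X U AP : Type*) where
  /-- actions allowed at a state -/
  acts : X → Finset U
  /-- possible labels of a state -/
  L : X → Finset (Set AP)
  /-- cost of a state-action pair -/
  cost : (x : X) → acts x → ℝ
  /-- initial state -/
  x₀ : X
  /-- initial label -/
  l₀ : L x₀
  /-- belief parameters of the transitions -/
  αD : (d : Σ x, acts x) → X → ℝ≥0
  /-- belief parameters of the labels -/
  αL : (x : X) → L x → ℝ≥0
  acts_nonempty : ∀ x, (acts x).Nonempty
  cost_pos : ∀ x u, 0 < cost x u
  αD_ne_zero : ∀ d, ∃ x', 0 < αD d x'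
  αL_ne_zero : ∀ x, ∃ l, 0 < αL x l

namespace UncertainMDP

variable {X U AP Q : Type*} [Fintype X] [Fintype Q]
set_option linter.unusedSectionVars false

/-- A sample: the transition probabilities `p_D` and the label probabilities `p_L`. -/
abbrev Sample (M : UncertainMDP X U AP) : Type _ :=
  ((_ : Σ x, M.acts x) → stdSimplex ℝ X) × ((x : X) → stdSimplex ℝ (M.L x))

/-- The belief: all the Dirichlet distributions, independent of each other. -/
def belief (M : UncertainMDP X U AP) : Measure M.Sample :=
  (Measure.pi fun d => dirichlet (M.αD d)).prod (Measure.pi fun x => dirichlet (M.αL x))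

instance (M : UncertainMDP X U AP) : IsProbabilityMeasure M.belief := by
  have h1 := fun d => isProbabilityMeasure_dirichlet (M.αD_ne_zero d)
  have h2 := fun x => isProbabilityMeasure_dirichlet (M.αL_ne_zero x)
  unfold belief
  infer_instance

/-- States `⟨x, l, q⟩` of the product, with `l ∈ L x`. -/
abbrev State (M : UncertainMDP X U AP) (Q : Type*) : Type _ := Σ x : X, M.L x × Q

/-- Actions allowed at a state of the product. -/
abbrev Act (M : UncertainMDP X U AP) (Q : Type*) (s : M.State Q) : Type _ := M.acts s.1

/-- Initial state of the product. -/
def start (M : UncertainMDP X U AP) (R : DRA AP Q) : M.State Q := ⟨M.x₀, M.l₀, R.init⟩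

open Classical in
/-- The transition probability `p_E` of the product, for a sample. -/
def pE (M : UncertainMDP X U AP) (R : DRA AP Q) (ω : M.Sample) (s : M.State Q) (u : M.Act Q s)
    (s' : M.State Q) : ℝ :=
  if s'.2.2 = R.δ s.2.2 s.2.1 then (ω.1 ⟨s.1, u⟩).1 s'.1 * (ω.2 s'.1).1 s'.2.1 else 0

lemma pE_nonneg (M : UncertainMDP X U AP) (R : DRA AP Q) (ω : M.Sample) (s : M.State Q)
    (u : M.Act Q s) (s' : M.State Q) : 0 ≤ M.pE R ω s u s' := by
  unfold pE
  split_ifs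
  · exact mul_nonneg ((ω.1 _).2.1 _) ((ω.2 _).2.1 _)
  · exact le_rfl

lemma sum_pE (M : UncertainMDP X U AP) (R : DRA AP Q) (ω : M.Sample) (s : M.State Q)
    (u : M.Act Q s) : ∑ s', M.pE R ω s u s' = 1 := by
  classical
  rw [← (ω.1 ⟨s.1, u⟩).2.2, Fintype.sum_sigma]
  refine Finset.sum_congr rfl fun x _ => ?_
  rw [Fintype.sum_prod_type]
  simp only [pE, Finset.sum_ite_eq', Finset.mem_univ, if_true]
  rw [← Finset.mul_sum, (ω.2 x).2.2, mul_one]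

lemma pE_le_one (M : UncertainMDP X U AP) (R : DRA AP Q) (ω : M.Sample) (s : M.State Q)
    (u : M.Act Q s) (s' : M.State Q) : M.pE R ω s u s' ≤ 1 := by
  rw [← M.sum_pE R ω s u]
  exact Finset.single_le_sum (fun i _ => M.pE_nonneg R ω s u i) (Finset.mem_univ s')

lemma measurable_pE (M : UncertainMDP X U AP) (R : DRA AP Q) (s : M.State Q) (u : M.Act Q s)
    (s' : M.State Q) : Measurable fun ω => M.pE R ω s u s' := by
  unfold pE
  split_ifs
  · have h1 : Measurable fun ω : M.Sample => (ω.1 ⟨s.1, u⟩).1 s'.1 :=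
      (measurable_pi_apply _).comp
        (measurable_subtype_coe.comp ((measurable_pi_apply _).comp measurable_fst))
    have h2 : Measurable fun ω : M.Sample => (ω.2 s'.1).1 s'.2.1 :=
      (measurable_pi_apply _).comp
        (measurable_subtype_coe.comp ((measurable_pi_apply _).comp measurable_snd))
    exact h1.mul h2
  · exact measurable_const

lemma integrable_pE (M : UncertainMDP X U AP) (R : DRA AP Q) (s : M.State Q) (u : M.Act Q s)
    (s' : M.State Q) : Integrable (fun ω => M.pE R ω s u s') M.belief :=
  Integrable.of_bound (M.measurable_pE R s u s').aestronglyMeasurable 1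
    (Filter.Eventually.of_forall fun ω => by
      rw [Real.norm_of_nonneg (M.pE_nonneg R ω s u s')]
      exact M.pE_le_one R ω s u s')

/-- The expected transition probability `E_α {p_E}`. -/
def meanPE (M : UncertainMDP X U AP) (R : DRA AP Q) (s : M.State Q) (u : M.Act Q s)
    (s' : M.State Q) : ℝ :=
  ∫ ω, M.pE R ω s u s' ∂M.belief

/-- The transition measure of the product of a sample with the automaton. -/
def prod (M : UncertainMDP X U AP) (R : DRA AP Q) (ω : M.Sample) (s : M.State Q)
    (u : M.Act Q s) : PMF (M.State Q) :=
  PMF.ofFintype (fun s' => ENNReal.ofReal (M.pE R ω s u s')) (by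
    rw [← ENNReal.ofReal_sum_of_nonneg fun i _ => M.pE_nonneg R ω s u i, M.sum_pE,
      ENNReal.ofReal_one])

/-- The expected transition measure of the product. -/
def mean (M : UncertainMDP X U AP) (R : DRA AP Q) (s : M.State Q) (u : M.Act Q s) :
    PMF (M.State Q) :=
  PMF.ofFintype (fun s' => ENNReal.ofReal (M.meanPE R s u s')) (by
    simp only [meanPE]
    rw [← ENNReal.ofReal_sum_of_nonneg fun i _ => integral_nonneg fun ω => M.pE_nonneg R ω s u i,
      ← integral_finsetSum _ fun i _ => M.integrable_pE R s u i]
    simp [M.sum_pE])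

/-- The possible successors `K_s^u` of a state-action pair. A Dirichlet vector is almost surely
positive exactly where its parameter is, so these are the `s'` with `p_E (s, u, s') > 0`, for
almost every sample. -/
def post (M : UncertainMDP X U AP) (R : DRA AP Q) (s : M.State Q) (u : M.Act Q s) :
    Set (M.State Q) :=
  {s' | s'.2.2 = R.δ s.2.2 s.2.1 ∧ 0 < M.αD ⟨s.1, u⟩ s'.1 ∧ 0 < M.αL s'.1 s'.2.1}

/-- `S_Ξ`: the union of the accepting maximal end components of the product. -/
def accSet (M : UncertainMDP X U AP) (R : DRA AP Q) : Set (M.State Q) :=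
  {s | ∃ p ∈ R.acc, ∃ C B,
    IsAMEC (A := M.Act Q) (M.post R) {s | s.2.2 ∈ p.1} {s | s.2.2 ∈ p.2} C B ∧ s ∈ C}

/-- `S_r`: the states of the product over the home states. -/
def homeSet (M : UncertainMDP X U AP) (Q : Type*) (Xr : Set X) : Set (M.State Q) :=
  {s | s.1 ∈ Xr}

open Classical in
/-- The correction term `σ_{s,u}`. -/
def sigma (M : UncertainMDP X U AP) (R : DRA AP Q) (e : Edge (M.Act Q)) : ℝ :=
  ∑ s' with s' ∈ M.post R e.1 e.2,
    ∫ ω, min 0 (M.pE R ω e.1 e.2 s' - M.meanPE R e.1 e.2 s') ∂M.belief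

open Classical in
/-- The exploration bonus `ξ_s^u`, with weights `gU`, `gL` and thresholds `aU`, `aL`. -/
def bonus (M : UncertainMDP X U AP) (gU gL aU aL : ℝ) (e : Edge (M.Act Q)) : ℝ :=
  let totU : ℝ := ∑ x' with 0 < M.αD ⟨e.1.1, e.2⟩ x', (M.αD ⟨e.1.1, e.2⟩ x' : ℝ)
  let totL : ℝ := ∑ x' with 0 < M.αD ⟨e.1.1, e.2⟩ x', ∑ l, (M.αL x' l : ℝ)
  if aU < totU ∧ aL < totL then 0 else gU / (1 + totU) + gL / (1 + totL)

/-- The cost `c_E` of the product. -/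
def costE (M : UncertainMDP X U AP) (e : Edge (M.Act Q)) : ℝ := M.cost e.1.1 e.2

/-- The expected transition measure of `P₁ = (1 - 1_{S_Ξ}) • P`. -/
def mean₁ (M : UncertainMDP X U AP) (R : DRA AP Q) : Trans (M.Act Q) :=
  killed (M.accSet R) (M.mean R)

/-- The expected transition measure of `P₂ = (1 - 1_{S_r}) • P`. -/
def mean₂ (M : UncertainMDP X U AP) (R : DRA AP Q) (Xr : Set X) : Trans (M.Act Q) :=
  killed (M.homeSet Q Xr) (M.mean R)

open Classical in
/-- The return value `v_s` of the return policy `πr`. -/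
def returnValue (M : UncertainMDP X U AP) (R : DRA AP Q) (Xr : Set X) (πr : Policy (M.Act Q))
    (s : M.State Q) : EReal :=
  expTotal (M.mean₂ R Xr) πr s fun e =>
    let b : ℝ := if e.1 ∈ M.homeSet Q Xr then 1 else 0
    b + (1 - b) * M.sigma R e

open Classical in
/-- The summand `b_{s,S_Ξ} + σ_{s,u}` of the satisfiability constraint. -/
def satTerm (M : UncertainMDP X U AP) (R : DRA AP Q) (e : Edge (M.Act Q)) : ℝ :=
  (if e.1 ∈ M.accSet R then 1 else 0) + M.sigma R e

/-! ### The prefix problem -/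

/-- The two constraints of the prefix problem. -/
def PrefixFeasible (M : UncertainMDP X U AP) (R : DRA AP Q) (Xr : Set X) (χo χr : ℝ)
    (πo πr : Policy (M.Act Q)) : Prop :=
  (χo : EReal) ≤ expTotal (M.mean₁ R) πo (M.start R) (M.satTerm R) ∧
  (χr : EReal) ≤ expFirst (M.mean₁ R) πo (M.start R) (M.returnValue R Xr πr) (M.sigma R)

/-- The objective of the prefix problem: expected total of cost minus bonus. -/
def prefixObjective (M : UncertainMDP X U AP) (R : DRA AP Q) (gU gL aU aL : ℝ)
    (πo : Policy (M.Act Q)) : EReal :=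
  expTotal (M.mean₁ R) πo (M.start R) fun e => M.costE e - M.bonus gU gL aU aL e

/-- `(πo, πr)` is an optimal solution of the prefix problem. -/
def PrefixOptimal (M : UncertainMDP X U AP) (R : DRA AP Q) (Xr : Set X)
    (gU gL aU aL χo χr : ℝ) (πo πr : Policy (M.Act Q)) : Prop :=
  M.PrefixFeasible R Xr χo χr πo πr ∧
  ∀ πo' πr', M.PrefixFeasible R Xr χo χr πo' πr' →
    M.prefixObjective R gU gL aU aL πo ≤ M.prefixObjective R gU gL aU aL πo'

/-- The constraints of the linear program over occupation measures `y (s, u)` for given return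
values `v`: non-negativity, flow balance, satisfiability, safety (the latter conditioned on the
current state being the initial one, hence homogeneous in `y`). -/
structure LPFeasible (M : UncertainMDP X U AP) (R : DRA AP Q) (χo χr : ℝ)
    (v : M.State Q → EReal) (y : Edge (M.Act Q) → ℝ) : Prop where
  nonneg : ∀ e, 0 ≤ y e
  flow : ∀ s' : M.State Q, ∑ u, y ⟨s', u⟩ =
    (open Classical in if s' = M.start R then 1 else 0) +
      ∑ e : Edge (M.Act Q), y e * (M.mean₁ R e.1 e.2 (some s')).toReal
  sat : χo ≤ ∑ e, y e * M.satTerm R e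
  safe : ((χr * ∑ u, y ⟨M.start R, u⟩ : ℝ) : EReal) ≤
    ∑ u, ((y ⟨M.start R, u⟩ : ℝ) : EReal) *
      ((∑ s', ((M.mean₁ R (M.start R) u (some s') : ℝ≥0∞) : EReal) * v s') +
        ((M.sigma R ⟨M.start R, u⟩ : ℝ) : EReal))

/-- `y` is an optimal solution of the linear program. -/
def LPOptimal (M : UncertainMDP X U AP) (R : DRA AP Q) (gU gL aU aL χo χr : ℝ)
    (v : M.State Q → EReal) (y : Edge (M.Act Q) → ℝ) : Prop :=
  M.LPFeasible R χo χr v y ∧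
  ∀ y', M.LPFeasible R χo χr v y' →
    ∑ e, y e * (M.costE e - M.bonus gU gL aU aL e) ≤
      ∑ e, y' e * (M.costE e - M.bonus gU gL aU aL e)

/-- `π` is a stationary policy with `π (s, u) = y (s, u) / ∑_w y (s, w)` wherever the denominator is
positive, and arbitrary elsewhere. -/
def IsDerivedFrom (M : UncertainMDP X U AP) (y : Edge (M.Act Q) → ℝ)
    (π : Policy (M.Act Q)) : Prop :=
  (∀ h h', π h = π h') ∧
  ∀ h s, 0 < ∑ w, y ⟨s, w⟩ → ∀ u, (π h s u).toReal = y ⟨s, u⟩ / ∑ w, y ⟨s, w⟩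

/-! ### The guarantees -/

/-- `E_α {Pr_{s₀}^{πo} (◇ S_Ξ)}`. -/
def expReach (M : UncertainMDP X U AP) (R : DRA AP Q) (πo : Policy (M.Act Q)) : ℝ≥0∞ :=
  ∫⁻ ω, reachProb (full (M.prod R ω)) πo (M.start R) (M.accSet R) ∂M.belief

/-- The safe-return probability of a sample at stage `0`: the outbound policy makes the first
move from the initial state, and from the state reached the return policy has to lead home. -/
def safe (M : UncertainMDP X U AP) (R : DRA AP Q) (Xr : Set X) (πo πr : Policy (M.Act Q))
    (ω : M.Sample) : ℝ≥0∞ :=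
  ∫⁻ r, Option.elim (r 1) 0
      (fun e => reachProb (full (M.prod R ω)) πr e.1 (M.homeSet Q Xr))
    ∂(runLaw (full (M.prod R ω)) πo (M.start R))

/-- `E_α {Safe^{πo, πr}}`. -/
def expSafe (M : UncertainMDP X U AP) (R : DRA AP Q) (Xr : Set X)
    (πo πr : Policy (M.Act Q)) : ℝ≥0∞ :=
  ∫⁻ ω, M.safe R Xr πo πr ω ∂M.belief

end UncertainMDP

end SafePlan

end

open MeasureTheory ProbabilityTheory
open scoped ENNReal NNReal

noncomputable section

namespace SafePlan

set_option linter.unusedSectionVars false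

/-! ### The law of runs, finite-horizon values and reachability -/

section RunLaw

variable {S : Type*} [Fintype S] {A : S → Type*} [∀ s, Fintype (A s)]

instance (T : Trans A) (π : Policy A) (s : S) : IsProbabilityMeasure (runLaw T π s) := by
  unfold runLaw
  infer_instance

/-- The terminated step. -/
def Step.dead : Step A := none

/-- The step with a given state-action pair. -/
def Step.live (e : Edge A) : Step A := some e

/-- A step as an optional state-action pair. -/
def Step.toOption (z : Step A) : Option (Edge A) := z

/-- The state-action pairs of a step: one or none. -/
def Step.toList (z : Step A) : List (Edge A) := z.toOption.toList

lemma Step.dead_or_live (z : Step A) : z = Step.dead ∨ ∃ e, z = Step.live e := by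
  rcases z with _ | e
  · exact .inl rfl
  · exact .inr ⟨e, rfl⟩

lemma Step.live_injective : Function.Injective (Step.live : Edge A → Step A) :=
  Option.some_injective _

lemma Step.live_ne_dead (e : Edge A) : Step.live e ≠ Step.dead := Option.some_ne_none e

/-- The state-action pairs of a run up to time `n`, oldest first. -/
def hist (r : ℕ → Step A) (n : ℕ) : List (Edge A) :=
  List.reduceOption ((List.range (n + 1)).map fun i => (r i).toOption)

/-- Trades indices in `Fin (n + 1)` for a range of naturals, so that histories can be extended one
step at a time. -/
lemma past_frestrictLe (r : ℕ → Step A) (n : ℕ) :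
    past n (Preorder.frestrictLe (π := fun _ => Step A) n r) = hist r n := by
  change List.reduceOption 
    ((List.finRange (n + 1)).map fun i : Fin (n + 1) => (r i.1).toOption) = _
  unfold hist
  rw [← List.map_coe_finRange_eq_range, List.map_map]
  rfl

lemma reduceOption_singleton_toOption (z : Step A) :
    List.reduceOption [z.toOption] = z.toList := by
  rcases z with _ | e <;> rfl

lemma hist_zero (r : ℕ → Step A) : hist r 0 = (r 0).toList :=
  reduceOption_singleton_toOption (r 0)

lemma hist_succ (r : ℕ → Step A) (n : ℕ) :
    hist r (n + 1) = hist r n ++ (r (n + 1)).toList := by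
  unfold hist
  rw [List.range_succ, List.map_append, List.reduceOption_append]
  exact congrArg _ (reduceOption_singleton_toOption _)

lemma hist_congr {r r' : ℕ → Step A} {n : ℕ} (h : ∀ i ≤ n, r i = r' i) :
    hist r n = hist r' n := by
  unfold hist
  congr 1
  exact List.map_congr_left fun i hi => by rw [h i (by simpa [Nat.lt_succ_iff] using hi)]

/-- A finite run, terminated after time `n`. -/
def extend (n : ℕ) (q : (_ : Finset.Iic n) → Step A) (i : ℕ) : Step A :=
  if h : i ≤ n then q ⟨i, Finset.mem_Iic.2 h⟩ else Step.dead

lemma extend_frestrictLe (r : ℕ → Step A) {n i : ℕ} (hi : i ≤ n) :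
    extend n (Preorder.frestrictLe (π := fun _ => Step A) n r) i = r i := by
  simp [extend, hi]

/-- The Markov property of the law of runs. -/
lemma integral_succ (T : Trans A) (π : Policy A) (s : S) (n : ℕ)
    (g : (ℕ → Step A) → Step A → ℝ)
    (hg : ∀ r r' z, (∀ i ≤ n, r i = r' i) → g r z = g r' z) :
    ∫ r, g r (r (n + 1)) ∂(runLaw T π s) =
      ∫ r, ∫ z, g r z ∂(nextLaw T π (hist r n) (r n)).toMeasure ∂(runLaw T π s) := by
  -- Disintegration: the joint law of the steps up to `n` and step `n + 1` is the law of the former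
  -- composed with `stepKernel`.
  have key := Kernel.map_frestrictLe_trajMeasure_compProd_eq_map_trajMeasure
    (X := fun _ => Step A) (μ₀ := (initLaw π s).toMeasure) (κ := stepKernel T π) (a := n)
  change ((runLaw T π s).map _) ⊗ₘ _ = (runLaw T π s).map _ at key
  have hm : Measurable (Preorder.frestrictLe (π := fun _ => Step A) n) := by fun_prop
  have hm' : Measurable fun x : ℕ → Step A =>
      (Preorder.frestrictLe (π := fun _ => Step A) n x, x (n + 1)) := by fun_prop
  -- As `g` sees only the steps up to `n`, padding with `dead` turns it into a function on a finite
  -- space, where measurability and integrability are automatic.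
  let w : ((_ : Finset.Iic n) → Step A) × Step A → ℝ := fun q => g (extend n q.1) q.2
  have hw : Measurable w := measurable_of_countable _
  have e1 : ∫ r, g r (r (n + 1)) ∂(runLaw T π s) = ∫ q, w q ∂((runLaw T π s).map fun x =>
      (Preorder.frestrictLe (π := fun _ => Step A) n x, x (n + 1))) := by
    rw [integral_map hm'.aemeasurable hw.aestronglyMeasurable]
    exact integral_congr_ae (.of_forall fun r =>
      hg _ _ _ fun i hi => (extend_frestrictLe r hi).symm)
  have : IsProbabilityMeasure ((runLaw T π s).map
    (Preorder.frestrictLe (π := fun _ => Step A) n)) := Measure.isProbabilityMeasure_map hm.aemeasurable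
  rw [e1, ← key, Measure.integral_compProd Integrable.of_finite,
    integral_map hm.aemeasurable (measurable_of_countable _).aestronglyMeasurable]
  refine integral_congr_ae (.of_forall fun r => ?_)
  change ∫ z, g _ z ∂(nextLaw T π (past n _) _).toMeasure = _
  rw [past_frestrictLe]
  exact integral_congr_ae (.of_forall fun z => hg _ _ _ fun i hi => extend_frestrictLe r hi)

/-- The law of the first step of a run. -/
lemma integral_zero_step (T : Trans A) (π : Policy A) (s : S) (g : Step A → ℝ) :
    ∫ r, g (r 0) ∂(runLaw T π s) = ∫ z, g z ∂(initLaw π s).toMeasure := by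
  have hm : Measurable (Preorder.frestrictLe (π := fun _ => Step A) 0) := by fun_prop
  have key : (runLaw T π s).map (Preorder.frestrictLe (π := fun _ => Step A) 0) =
      ((initLaw π s).toMeasure).map
        (MeasurableEquiv.piUnique (fun _ : Finset.Iic 0 => Step A)).symm := by
    unfold runLaw Kernel.trajMeasure
    rw [Measure.map_comp _ _ hm, Kernel.traj_map_frestrictLe, Kernel.partialTraj_self]
    exact Measure.id_comp
  let w : ((_ : Finset.Iic 0) → Step A) → ℝ := fun q => g (q ⟨0, by simp⟩)
  have e1 : ∫ r, g (r 0) ∂(runLaw T π s) =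
      ∫ q, w q ∂((runLaw T π s).map (Preorder.frestrictLe (π := fun _ => Step A) 0)) := by
    rw [integral_map hm.aemeasurable (measurable_of_countable _).aestronglyMeasurable]
    rfl
  rw [e1, key, integral_map (MeasurableEquiv.measurable _).aemeasurable
    (measurable_of_countable _).aestronglyMeasurable]
  rfl

lemma integral_initLaw (π : Policy A) (s : S) (g : Step A → ℝ) :
    ∫ z, g z ∂(initLaw π s).toMeasure = ∑ u, (π [] s u).toReal * g (.live ⟨s, u⟩) := by
  let _ : MeasurableSpace (A s) := ⊤
  change ∫ z, g z ∂((π [] s).map fun u => Step.live ⟨s, u⟩).toMeasure = _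
  rw [← PMF.toMeasure_map _ _ (measurable_of_countable _),
    integral_map (measurable_of_countable _).aemeasurable
      (measurable_of_countable _).aestronglyMeasurable, PMF.integral_eq_sum]
  rfl

/-- The pair reached determines both the successor and the action drawn there, so a single term of
the mixture contributes. -/
lemma nextLaw_live_apply (T : Trans A) (π : Policy A) (h : List (Edge A)) (e : Edge A) (s' : S)
    (u' : A s') :
    nextLaw T π h (.live e) (.live ⟨s', u'⟩) = T e.1 e.2 (some s') * π h s' u' := by
  classical
  have h1 : ∀ a : S, ((π h a).map fun u => Step.live ⟨a, u⟩) (.live ⟨s', u'⟩) =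
      if a = s' then π h s' u' else 0 := by
    intro a
    rw [PMF.map_apply, tsum_fintype]
    split_ifs with ha
    · subst ha
      rw [Finset.sum_eq_single u']
      · simp
      · intro b _ hb
        rw [if_neg]
        intro hc
        obtain hc := Step.live_injective hc
        injection hc with _ hc
        exact hb hc.symm
      · simp
    · refine Finset.sum_eq_zero fun b _ => ?_
      rw [if_neg]
      intro hc
      obtain hc := Step.live_injective hc
      injection hc with hc _
      exact ha hc.symm
  let k : Option S → PMF (Step A) := fun o =>
    o.elim (PMF.pure Step.dead) fun a => (π h a).map fun u => Step.live ⟨a, u⟩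
  have hk : nextLaw T π h (.live e) = (T e.1 e.2).bind k := by
    change (T e.1 e.2).bind _ = _
    congr 1
    funext o
    rcases o with _ | a <;> rfl
  rw [hk, PMF.bind_apply, tsum_fintype, Fintype.sum_option]
  have h0 : k none (.live ⟨s', u'⟩) = 0 := by
    change PMF.pure Step.dead _ = 0
    rw [PMF.pure_apply, if_neg (Step.live_ne_dead _)]
  have h2 : ∀ a, k (some a) (.live ⟨s', u'⟩) = if a = s' then π h s' u' else 0 := h1
  simp only [h0, h2, mul_zero, zero_add, mul_ite, Finset.sum_ite_eq', Finset.mem_univ, if_true]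

instance : Fintype (Step A) := inferInstanceAs (Fintype (Option (Edge A)))

lemma sum_step (f : Step A → ℝ) : ∑ z, f z = f .dead + ∑ e, f (.live e) :=
  Fintype.sum_option (α := Edge A) f

lemma integral_nextLaw (T : Trans A) (π : Policy A) (h : List (Edge A)) (e : Edge A)
    (g : Step A → ℝ) (hg : g .dead = 0) :
    ∫ z, g z ∂(nextLaw T π h (.live e)).toMeasure =
      ∑ s', (T e.1 e.2 (some s')).toReal * ∑ u', (π h s' u').toReal * g (.live ⟨s', u'⟩) := by
  rw [PMF.integral_eq_sum, sum_step, hg, smul_zero, zero_add, Fintype.sum_sigma]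
  refine Finset.sum_congr rfl fun s' _ => ?_
  rw [Finset.mul_sum]
  refine Finset.sum_congr rfl fun u' _ => ?_
  rw [nextLaw_live_apply, ENNReal.toReal_mul, smul_eq_mul, mul_assoc]

lemma integral_nextLaw_dead (T : Trans A) (π : Policy A) (h : List (Edge A)) (g : Step A → ℝ) :
    ∫ z, g z ∂(nextLaw T π h .dead).toMeasure = g .dead := by
  change ∫ z, g z ∂(PMF.pure Step.dead).toMeasure = _
  rw [PMF.toMeasure_pure, integral_dirac]

/-- The expected total of `f` over `k` steps, from the state `s` with past `h`. -/
def val (T : Trans A) (π : Policy A) (f : Edge A → ℝ) : ℕ → List (Edge A) → S → ℝ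
  | 0, _, _ => 0
  | k + 1, h, s => ∑ u, (π h s u).toReal *
      (f ⟨s, u⟩ + ∑ s', (T s u (some s')).toReal * val T π f k (h ++ [⟨s, u⟩]) s')

/-- The expected total of `f` over the current step `z`, already included in the past `h`, and
`k` further ones. -/
def contVal (T : Trans A) (π : Policy A) (f : Edge A → ℝ) (k : ℕ) (h : List (Edge A))
    (z : Step A) : ℝ :=
  z.toOption.elim 0 fun e => f e + ∑ s', (T e.1 e.2 (some s')).toReal * val T π f k h s'

lemma val_succ (T : Trans A) (π : Policy A) (f : Edge A → ℝ) (k : ℕ) (h : List (Edge A)) (s : S) :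
    val T π f (k + 1) h s =
      ∑ u, (π h s u).toReal * contVal T π f k (h ++ [⟨s, u⟩]) (.live ⟨s, u⟩) := rfl

lemma contVal_zero (T : Trans A) (π : Policy A) (f : Edge A → ℝ) (h : List (Edge A))
    (z : Step A) : contVal T π f 0 h z = stepVal f z := by
  rcases z.dead_or_live with rfl | ⟨e, rfl⟩
  · rfl
  · change f e + _ = f e
    simp [val]

/-- Two transition measures are allowed, agreeing only at `e`: runs follow the unkilled process
while values are computed in the killed one, and the two coincide off the target. -/
lemma integral_contVal (T T' : Trans A) (π : Policy A) (f : Edge A → ℝ) (k : ℕ)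
    (h : List (Edge A)) (e : Edge A) (hT : T' e.1 e.2 = T e.1 e.2) :
    ∫ z, contVal T π f k (h ++ z.toList) z ∂(nextLaw T' π h (.live e)).toMeasure =
      contVal T π f (k + 1) h (.live e) - f e := by
  rw [integral_nextLaw _ _ _ _ _ rfl, hT]
  change _ = f e + _ - f e
  rw [add_sub_cancel_left]
  rfl

/-- The expected total over a finite horizon is computed by backward induction. -/
lemma integral_sum_stepVal (T : Trans A) (π : Policy A) (s : S) (f : Edge A → ℝ) (N : ℕ) :
    ∫ r, ∑ t ∈ Finset.range N, stepVal f (r t) ∂(runLaw T π s) = val T π f N [] s := by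
  rcases N with _ | N
  · simp [val]
  -- Collected reward plus expected remaining reward is a martingale: its mean is the same for all
  -- `n`. At `n = 0` it is the backward value; at `n = N` the last step is worth just its own
  -- reward, which gives the `N + 1` terms.
  have main : ∀ n k, n + k = N →
      ∫ r, (∑ t ∈ Finset.range n, stepVal f (r t) + contVal T π f k (hist r n) (r n))
        ∂(runLaw T π s) = val T π f (N + 1) [] s := by
    intro n
    induction n with
    | zero =>
      rintro k hk
      obtain rfl : k = N := by omega
      simp only [Finset.range_zero, Finset.sum_empty, zero_add]
      simp only [hist_zero]
      rw [integral_zero_step T π s fun z => contVal T π f k z.toList z, integral_initLaw, val_succ]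
      rfl
    | succ n ih =>
      intro k hk
      rw [← ih (k + 1) (by omega)]
      simp only [hist_succ]
      rw [integral_succ T π s n (fun r z => ∑ t ∈ Finset.range (n + 1), stepVal f (r t) +
        contVal T π f k (hist r n ++ z.toList) z)]
      · refine integral_congr_ae (.of_forall fun r => ?_)
        beta_reduce
        rw [integral_add Integrable.of_finite Integrable.of_finite, integral_const]
        rw [probReal_univ, one_smul, Finset.sum_range_succ, add_assoc]
        congr 1
        rcases (r n).dead_or_live with h | ⟨e, h⟩ <;> rw [h]
        · rw [integral_nextLaw_dead]
          exact zero_add _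
        · rw [integral_contVal _ _ _ _ _ _ _ rfl]
          change f e + _ = _
          ring
      · intro r r' z hr
        rw [hist_congr hr]
        congr 1
        refine Finset.sum_congr rfl fun t ht => ?_
        rw [hr t (by simpa [Nat.lt_succ_iff] using ht)]
  rw [← main N 0 rfl]
  simp only [contVal_zero, ← Finset.sum_range_succ]

open Classical in
/-- The indicator of a set of states, as a function of state-action pairs. -/
def ind (G : Set S) (e : Edge A) : ℝ := if e.1 ∈ G then 1 else 0

open Classical in
/-- The probability of a visit to `G` up to time `N` is the expected number of visits when the
process is killed there. -/
lemma integral_visit (P : (s : S) → A s → PMF S) (π : Policy A) (s : S) (G : Set S) (N : ℕ) :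
    ∫ r, (if ∃ t ≤ N, ∃ e : Edge A, r t = .live e ∧ e.1 ∈ G then (1 : ℝ) else 0)
      ∂(runLaw (full P) π s) = val (killed G P) π (ind G) (N + 1) [] s := by
  -- The martingale here is the conditional probability of a visit: `1` after a visit before time
  -- `n`, otherwise the killed value from the current step on.
  have main : ∀ n k, n + k = N →
      ∫ r, (if ∃ t < n, ∃ e : Edge A, r t = .live e ∧ e.1 ∈ G then (1 : ℝ) else
        contVal (killed G P) π (ind G) k (hist r n) (r n))
        ∂(runLaw (full P) π s) = val (killed G P) π (ind G) (N + 1) [] s := by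
    intro n
    induction n with
    | zero =>
      rintro k hk
      obtain rfl : k = N := by omega
      simp only [Nat.not_lt_zero, false_and, exists_false, if_false]
      simp only [hist_zero]
      rw [integral_zero_step (full P) π s fun z => contVal (killed G P) π (ind G) k z.toList z, integral_initLaw, val_succ]
      rfl
    | succ n ih =>
      intro k hk
      rw [← ih (k + 1) (by omega)]
      simp only [hist_succ]
      rw [integral_succ (full P) π s n (fun r z =>
        if ∃ t < n + 1, ∃ e : Edge A, r t = .live e ∧ e.1 ∈ G then (1 : ℝ) else
        contVal (killed G P) π (ind G) k (hist r n ++ z.toList) z)]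
      · refine integral_congr_ae (.of_forall fun r => ?_)
        beta_reduce
        by_cases hv : ∃ t < n, ∃ e : Edge A, r t = .live e ∧ e.1 ∈ G
        · have hv' : ∃ t < n + 1, ∃ e : Edge A, r t = .live e ∧ e.1 ∈ G := by
            obtain ⟨t, ht, h⟩ := hv
            exact ⟨t, by omega, h⟩
          simp only [if_pos hv, if_pos hv']
          simp
        rw [if_neg hv]
        rcases (r n).dead_or_live with h | ⟨e, h⟩ <;> rw [h]
        · rw [integral_nextLaw_dead, if_neg]
          · rfl
          · rintro ⟨t, ht, e, he, heG⟩
            rcases Nat.lt_succ_iff_lt_or_eq.1 ht with ht | rfl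
            · exact hv ⟨t, ht, e, he, heG⟩
            · rw [h] at he
              cases he
        -- At a first visit the killed process earns `1` and stops, matching the frozen value `1`.
        -- Off `G` it earns nothing and moves like `full P`.
        · by_cases heG : e.1 ∈ G
          · have hv' : ∃ t < n + 1, ∃ e : Edge A, r t = .live e ∧ e.1 ∈ G :=
              ⟨n, by omega, e, h, heG⟩
            simp only [if_pos hv']
            change _ = ind G e + _
            simp [ind, killed, heG]
          · have hv' : ¬ ∃ t < n + 1, ∃ e : Edge A, r t = .live e ∧ e.1 ∈ G := by
              rintro ⟨t, ht, e', he, heG'⟩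
              rcases Nat.lt_succ_iff_lt_or_eq.1 ht with ht | rfl
              · exact hv ⟨t, ht, e', he, heG'⟩
              · rw [h] at he
                injection he with he
                exact heG (he ▸ heG')
            simp only [if_neg hv']
            rw [integral_contVal]
            · simp [ind, heG]
            · simp [full, killed, heG]
      · intro r r' z hr
        rw [hist_congr hr]
        have : (∃ t < n + 1, ∃ e : Edge A, r t = .live e ∧ e.1 ∈ G) ↔
            ∃ t < n + 1, ∃ e : Edge A, r' t = .live e ∧ e.1 ∈ G := by
          refine exists_congr fun t => and_congr_right fun ht => ?_
          rw [hr t (by omega)]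
        simp only [this]
  rw [← main N 0 rfl]
  refine integral_congr_ae (.of_forall fun r => ?_)
  beta_reduce
  by_cases hv : ∃ t < N, ∃ e : Edge A, r t = .live e ∧ e.1 ∈ G
  · have hv' : ∃ t ≤ N, ∃ e : Edge A, r t = .live e ∧ e.1 ∈ G := by
      obtain ⟨t, ht, h⟩ := hv
      exact ⟨t, ht.le, h⟩
    rw [if_pos hv, if_pos hv']
  · rw [if_neg hv, contVal_zero]
    have : (∃ t ≤ N, ∃ e : Edge A, r t = .live e ∧ e.1 ∈ G) ↔
        ∃ e : Edge A, r N = .live e ∧ e.1 ∈ G := by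
      constructor
      · rintro ⟨t, ht, h⟩
        rcases ht.lt_or_eq with ht | rfl
        · exact (hv ⟨t, ht, h⟩).elim
        · exact h
      · exact fun h => ⟨N, le_rfl, h⟩
    simp only [this]
    rcases (r N).dead_or_live with h | ⟨e, h⟩ <;> rw [h]
    · rw [if_neg]
      · rfl
      · rintro ⟨e, he, -⟩
        cases he
    · change _ = ind G e
      unfold ind
      refine if_congr ⟨?_, fun h => ⟨e, rfl, h⟩⟩ rfl rfl
      rintro ⟨e', he, h⟩
      injection he with he
      exact he ▸ h

/-- For a positive horizon the value is the probability of a visit within it, and such runs lie in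
the reachability event. -/
lemma val_le_reachProb (P : (s : S) → A s → PMF S) (π : Policy A) (s : S) (G : Set S) (N : ℕ) :
    ENNReal.ofReal (val (killed G P) π (ind G) N [] s) ≤ reachProb (full P) π s G := by
  classical
  rcases N with _ | N
  · simp [val]
  have hE : MeasurableSet {r : ℕ → Step A | ∃ t ≤ N, ∃ e : Edge A, r t = .live e ∧ e.1 ∈ G} := by
    have : {r : ℕ → Step A | ∃ t ≤ N, ∃ e : Edge A, r t = .live e ∧ e.1 ∈ G} =
        ⋃ t ≤ N, (fun r : ℕ → Step A => r t) ⁻¹' {z | ∃ e : Edge A, z = .live e ∧ e.1 ∈ G} := by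
      ext r
      simp
    rw [this]
    exact .iUnion fun t => .iUnion fun _ => measurable_pi_apply t (.of_discrete)
  have h := integral_visit P π s G N
  have h' : ∫ r, (if ∃ t ≤ N, ∃ e : Edge A, r t = .live e ∧ e.1 ∈ G then (1 : ℝ) else 0)
      ∂(runLaw (full P) π s) = (runLaw (full P) π s).real
        {r : ℕ → Step A | ∃ t ≤ N, ∃ e : Edge A, r t = .live e ∧ e.1 ∈ G} := by
    rw [← integral_indicator_one hE]
    refine integral_congr_ae (.of_forall fun r => ?_)
    simp [Set.indicator_apply]
  rw [← h, h', ofReal_measureReal]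
  refine measure_mono ?_
  rintro r ⟨t, -, h⟩
  exact ⟨t, h⟩

end RunLaw

/-! ### Comparison of the random process with its mean -/

section Simulation

variable {S : Type*} [Fintype S] {A : S → Type*} [∀ s, Fintype (A s)]

lemma sum_toReal_pmf {α : Type*} [Fintype α] (p : PMF α) : ∑ a, (p a).toReal = 1 := by
  rw [← ENNReal.toReal_sum fun a _ => p.apply_ne_top a, ← tsum_fintype (L := .unconditional α) (fun a => p a),
    p.tsum_coe, ENNReal.toReal_one]

lemma killed_apply_of_mem (P : (s : S) → A s → PMF S) {G : Set S} {s : S} (h : s ∈ G) (u : A s)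
    (s' : S) : killed G P s u (some s') = 0 := by
  simp [killed, h]

lemma map_some_apply (p : PMF S) (s' : S) : p.map some (some s') = p s' := by
  classical
  rw [PMF.map_apply, tsum_fintype]
  simp [Finset.sum_ite_eq]

lemma killed_apply_of_notMem (P : (s : S) → A s → PMF S) {G : Set S} {s : S} (h : s ∉ G)
    (u : A s) (s' : S) : killed G P s u (some s') = P s u s' := by
  simp only [killed, h, if_false]
  exact map_some_apply _ _

/-- The killed process is paid at most once, since a visit to `G` ends it. -/
lemma val_killed_mem_Icc (P : (s : S) → A s → PMF S) (π : Policy A) (G : Set S) (k : ℕ)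
    (h : List (Edge A)) (s : S) : val (killed G P) π (ind G) k h s ∈ Set.Icc (0 : ℝ) 1 := by
  induction k generalizing h s with
  | zero => simp [val]
  | succ k ih =>
    have key : ∀ u : A s, (ind G ⟨s, u⟩ + ∑ s', (killed G P s u (some s')).toReal *
        val (killed G P) π (ind G) k (h ++ [⟨s, u⟩]) s') ∈ Set.Icc (0 : ℝ) 1 := by
      intro u
      by_cases hs : s ∈ G
      · simp [ind, hs, killed_apply_of_mem P hs]
      · simp only [ind, hs, if_false, zero_add, killed_apply_of_notMem P hs]
        refine ⟨Finset.sum_nonneg fun s' _ => mul_nonneg ENNReal.toReal_nonneg (ih _ _).1, ?_⟩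
        rw [← sum_toReal_pmf (P s u)]
        exact Finset.sum_le_sum fun s' _ =>
          mul_le_of_le_one_right ENNReal.toReal_nonneg (ih _ _).2
    refine ⟨Finset.sum_nonneg fun u _ => mul_nonneg ENNReal.toReal_nonneg (key u).1, ?_⟩
    rw [← sum_toReal_pmf (π h s)]
    exact Finset.sum_le_sum fun u _ => mul_le_of_le_one_right ENNReal.toReal_nonneg (key u).2

variable {Ω : Type*} [MeasurableSpace Ω] {P : Ω → (s : S) → A s → PMF S}

lemma measurable_val_killed (hP : ∀ s u s', Measurable fun ω => (P ω s u s').toReal)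
    (π : Policy A) (G : Set S) (k : ℕ) (h : List (Edge A)) (s : S) :
    Measurable fun ω => val (killed G (P ω)) π (ind G) k h s := by
  induction k generalizing h s with
  | zero => exact measurable_const
  | succ k ih =>
    refine Finset.measurable_sum _ fun u _ => (Measurable.const_mul (Measurable.const_add
      (Finset.measurable_sum _ fun s' _ => Measurable.mul ?_ (ih _ _)) _) _)
    by_cases hs : s ∈ G
    · simp only [killed_apply_of_mem _ hs]
      exact measurable_const
    · simp only [killed_apply_of_notMem _ hs]
      exact hP s u s'

/-- `σ` bounds from below the loss in one step when the random transition probabilities `P` are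
replaced by `Pm`, for whatever random values in `[0, 1]` of the successors. -/
def StepBound (μ : Measure Ω) (P : Ω → (s : S) → A s → PMF S) (Pm : (s : S) → A s → PMF S)
    (σ : Edge A → ℝ) : Prop :=
  ∀ s u (W : S → Ω → ℝ), (∀ s', Measurable (W s')) → (∀ s' ω, W s' ω ∈ Set.Icc (0 : ℝ) 1) →
    ∑ s', (Pm s u s').toReal * ∫ ω, W s' ω ∂μ + σ ⟨s, u⟩ ≤
      ∫ ω, ∑ s', (P ω s u s').toReal * W s' ω ∂μ

lemma integrable_of_mem_Icc {μ : Measure Ω} [IsFiniteMeasure μ] {f : Ω → ℝ} (hf : Measurable f)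
    (h : ∀ ω, f ω ∈ Set.Icc (0 : ℝ) 1) : Integrable f μ :=
  Integrable.of_bound hf.aestronglyMeasurable 1 (.of_forall fun ω => by
    rw [Real.norm_of_nonneg (h ω).1]
    exact (h ω).2)

lemma toReal_pmf_mem_Icc {α : Type*} (p : PMF α) (a : α) : (p a).toReal ∈ Set.Icc (0 : ℝ) 1 :=
  ⟨ENNReal.toReal_nonneg, by
    simpa using ENNReal.toReal_mono ENNReal.one_ne_top (p.coe_le_one a)⟩

lemma integrable_pmf_mul {μ : Measure Ω} [IsFiniteMeasure μ]
    (hP : ∀ s u s', Measurable fun ω => (P ω s u s').toReal) (s : S) (u : A s) (s' : S)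
    {W : Ω → ℝ} (hW : Measurable W) (hW' : ∀ ω, W ω ∈ Set.Icc (0 : ℝ) 1) :
    Integrable (fun ω => (P ω s u s').toReal * W ω) μ :=
  integrable_of_mem_Icc ((hP s u s').mul hW) fun ω =>
    ⟨mul_nonneg ENNReal.toReal_nonneg (hW' ω).1,
      mul_le_one₀ (toReal_pmf_mem_Icc _ _).2 (hW' ω).1 (hW' ω).2⟩

/-- The simulation inequality: the mean of the reachability probabilities is at least the
reachability value of the mean process, corrected by `σ`. -/
lemma val_le_integral_val {μ : Measure Ω} [IsProbabilityMeasure μ]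
    {Pm : (s : S) → A s → PMF S} {σ : Edge A → ℝ}
    (hP : ∀ s u s', Measurable fun ω => (P ω s u s').toReal) (hσ : StepBound μ P Pm σ)
    (π : Policy A) (G : Set S) {f : Edge A → ℝ}
    (hf : ∀ e, f e ≤ ind G e + (1 - ind G e) * σ e) (k : ℕ) (h : List (Edge A)) (s : S) :
    val (killed G Pm) π f k h s ≤ ∫ ω, val (killed G (P ω)) π (ind G) k h s ∂μ := by
  induction k generalizing h s with
  | zero => simp [val]
  | succ k ih =>
    by_cases hs : s ∈ G
    -- On the target both processes stop at once, and `hf` reads `f ≤ 1`.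
    · simp only [val, killed_apply_of_mem _ hs, ENNReal.toReal_zero, zero_mul,
        Finset.sum_const_zero, add_zero, integral_const, probReal_univ, one_smul]
      refine Finset.sum_le_sum fun u _ => mul_le_mul_of_nonneg_left ?_ ENNReal.toReal_nonneg
      simpa [ind, hs] using hf ⟨s, u⟩
    · simp only [val, killed_apply_of_notMem _ hs]
      have hV := fun (u : A s) (s' : S) =>
        measurable_val_killed hP π G k (h ++ [⟨s, u⟩]) s'
      have hV' := fun (u : A s) (s' : S) ω =>
        val_killed_mem_Icc (P ω) π G k (h ++ [⟨s, u⟩]) s'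
      have hi : ∀ u : A s, Integrable (fun ω => ∑ s', (P ω s u s').toReal *
          val (killed G (P ω)) π (ind G) k (h ++ [⟨s, u⟩]) s') μ := fun u =>
        integrable_finsetSum _ fun s' _ => integrable_pmf_mul hP s u s' (hV u s') (hV' u s')
      have h0 : ∀ u, ind G (⟨s, u⟩ : Edge A) = 0 := fun u => by simp [ind, hs]
      simp only [h0, zero_add]
      rw [integral_finsetSum _ fun u _ => (hi u).const_mul _]
      refine Finset.sum_le_sum fun u _ => ?_
      rw [integral_const_mul]
      refine mul_le_mul_of_nonneg_left ?_ ENNReal.toReal_nonneg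
      -- The continuation value depends on the same `ω` as the transition, so its mean does not
      -- factor; `StepBound` allows for exactly this. The policy weights do not depend on `ω` and
      -- were pulled out.
      refine le_trans ?_ (hσ s u _ (hV u) (hV' u))
      rw [add_comm]
      refine add_le_add (Finset.sum_le_sum fun s' _ =>
        mul_le_mul_of_nonneg_left (ih _ _) ENNReal.toReal_nonneg) ?_
      simpa [h0] using hf ⟨s, u⟩

/-- Monotonicity of the lower integral asks no measurability of `g`. Hence reachability
probabilities never have to be shown measurable in the sample. -/
lemma ofReal_integral_le_lintegral {μ : Measure Ω} [IsFiniteMeasure μ] {f : Ω → ℝ}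
    {g : Ω → ℝ≥0∞} (hf : Measurable f) (hf' : ∀ ω, f ω ∈ Set.Icc (0 : ℝ) 1)
    (h : ∀ ω, ENNReal.ofReal (f ω) ≤ g ω) :
    ENNReal.ofReal (∫ ω, f ω ∂μ) ≤ ∫⁻ ω, g ω ∂μ := by
  rw [ofReal_integral_eq_lintegral_ofReal (integrable_of_mem_Icc hf hf')
    (.of_forall fun ω => (hf' ω).1)]
  exact lintegral_mono h

/-- The probability of a visit to `G` in the random process `P`. -/
def limVal (P : (s : S) → A s → PMF S) (π : Policy A) (G : Set S) (s : S) : ℝ :=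
  ⨆ k, val (killed G P) π (ind G) k [] s

lemma bddAbove_val (P : (s : S) → A s → PMF S) (π : Policy A) (G : Set S) (s : S) :
    BddAbove (Set.range fun k => val (killed G P) π (ind G) k [] s) := by
  refine ⟨1, ?_⟩
  rintro _ ⟨k, rfl⟩
  exact (val_killed_mem_Icc P π G k [] s).2

lemma limVal_mem_Icc (P : (s : S) → A s → PMF S) (π : Policy A) (G : Set S) (s : S) :
    limVal P π G s ∈ Set.Icc (0 : ℝ) 1 :=
  ⟨Real.iSup_nonneg fun k => (val_killed_mem_Icc P π G k [] s).1,
    ciSup_le fun k => (val_killed_mem_Icc P π G k [] s).2⟩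

lemma measurable_limVal (hP : ∀ s u s', Measurable fun ω => (P ω s u s').toReal)
    (π : Policy A) (G : Set S) (s : S) : Measurable fun ω => limVal (P ω) π G s :=
  Measurable.iSup fun k => measurable_val_killed hP π G k [] s

lemma reachProb_le_one (T : Trans A) (π : Policy A) (s : S) (G : Set S) :
    reachProb T π s G ≤ 1 := prob_le_one

lemma limVal_le_reachProb (P : (s : S) → A s → PMF S) (π : Policy A) (G : Set S) (s : S) :
    ENNReal.ofReal (limVal P π G s) ≤ reachProb (full P) π s G := by
  have ht := ((reachProb_le_one (full P) π s G).trans_lt ENNReal.one_lt_top).ne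
  refine ENNReal.ofReal_le_of_le_toReal (ciSup_le fun k => ?_)
  exact (ENNReal.ofReal_le_iff_le_toReal ht).1 (val_le_reachProb P π s G k)

lemma val_le_lintegral_reachProb {μ : Measure Ω} [IsProbabilityMeasure μ]
    {Pm : (s : S) → A s → PMF S} {σ : Edge A → ℝ}
    (hP : ∀ s u s', Measurable fun ω => (P ω s u s').toReal) (hσ : StepBound μ P Pm σ)
    (π : Policy A) (G : Set S) {f : Edge A → ℝ}
    (hf : ∀ e, f e ≤ ind G e + (1 - ind G e) * σ e) (k : ℕ) (s : S) :
    ENNReal.ofReal (val (killed G Pm) π f k [] s) ≤ ∫⁻ ω, reachProb (full (P ω)) π s G ∂μ :=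
  (ENNReal.ofReal_le_ofReal (val_le_integral_val hP hσ π G hf k [] s)).trans
    (ofReal_integral_le_lintegral (measurable_val_killed hP π G k [] s)
      (fun ω => val_killed_mem_Icc (P ω) π G k [] s)
      fun ω => val_le_reachProb (P ω) π s G k)

lemma expTotal_eq_limsup_val (T : Trans A) (π : Policy A) (s : S) (f : Edge A → ℝ) :
    expTotal T π s f = Filter.limsup (fun N => ((val T π f N [] s : ℝ) : EReal)) Filter.atTop := by
  unfold expTotal
  simp only [integral_sum_stepVal]

lemma expTotal_le (T : Trans A) (π : Policy A) (s : S) (f : Edge A → ℝ) {c : ℝ}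
    (h : ∀ N, val T π f N [] s ≤ c) : expTotal T π s f ≤ c := by
  rw [expTotal_eq_limsup_val]
  refine (Filter.limsup_le_limsup (.of_forall fun N => EReal.coe_le_coe_iff.2 (h N))).trans ?_
  exact (Filter.limsup_const _).le

/-- `limVal` dominates the values of all horizons, so one bound serves for the upper limit. Being
measurable in the sample and `[0, 1]`-valued, it can then play the role of `W` in `StepBound`. -/
lemma expTotal_le_integral_limVal {μ : Measure Ω} [IsProbabilityMeasure μ]
    {Pm : (s : S) → A s → PMF S} {σ : Edge A → ℝ}
    (hP : ∀ s u s', Measurable fun ω => (P ω s u s').toReal) (hσ : StepBound μ P Pm σ)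
    (π : Policy A) (G : Set S) {f : Edge A → ℝ}
    (hf : ∀ e, f e ≤ ind G e + (1 - ind G e) * σ e) (s : S) :
    expTotal (killed G Pm) π s f ≤ ((∫ ω, limVal (P ω) π G s ∂μ : ℝ) : EReal) :=
  expTotal_le _ _ _ _ fun N => (val_le_integral_val hP hσ π G hf N [] s).trans <|
    integral_mono
      (integrable_of_mem_Icc (measurable_val_killed hP π G N [] s)
        fun ω => val_killed_mem_Icc (P ω) π G N [] s)
      (integrable_of_mem_Icc (measurable_limVal hP π G s) fun ω => limVal_mem_Icc (P ω) π G s)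
      fun ω => le_ciSup (bddAbove_val (P ω) π G s) N

/-- The mean of the values reached in one step from `s` with the action `u`. -/
def stepMean (μ : Measure Ω) (P : Ω → (s : S) → A s → PMF S) (W : S → Ω → ℝ) (s : S)
    (u : A s) : ℝ :=
  ∫ ω, ∑ s', (P ω s u s').toReal * W s' ω ∂μ

lemma integral_stepVal_one (P : (s : S) → A s → PMF S) (π : Policy A) (s : S) (w : S → ℝ) :
    ∫ r, stepVal (fun e => w e.1) (r 1) ∂(runLaw (full P) π s) =
      ∑ u, (π [] s u).toReal * ∑ s', (P s u s').toReal * w s' := by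
  rw [integral_succ (full P) π s 0 (fun _ z => stepVal (fun e => w e.1) z) fun _ _ _ _ => rfl]
  simp only [hist_zero]
  rw [integral_zero_step (full P) π s fun z =>
    ∫ z', stepVal (fun e : Edge A => w e.1) z' ∂(nextLaw (full P) π z.toList z).toMeasure,
    integral_initLaw]
  refine Finset.sum_congr rfl fun u _ => ?_
  rw [integral_nextLaw _ _ _ _ _ rfl]
  congr 1
  refine Finset.sum_congr rfl fun s' _ => ?_
  rw [show full P s u (some s') = P s u s' from map_some_apply _ _]
  congr 1
  -- Step `1` also carries an action, whose probabilities sum to one because `w` sees only the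
  -- state.
  change ∑ u', _ * w s' = w s'
  rw [← Finset.sum_mul, sum_toReal_pmf, one_mul]

lemma ofReal_sum_le_lintegral_elim (P : (s : S) → A s → PMF S) (π : Policy A) (s : S)
    {w : S → ℝ} {R : S → ℝ≥0∞} (hw : ∀ s', w s' ∈ Set.Icc (0 : ℝ) 1)
    (hR : ∀ s', ENNReal.ofReal (w s') ≤ R s') :
    ENNReal.ofReal (∑ u, (π [] s u).toReal * ∑ s', (P s u s').toReal * w s') ≤
      ∫⁻ r, Option.elim (r 1) 0 (fun e => R e.1) ∂(runLaw (full P) π s) := by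
  rw [← integral_stepVal_one]
  refine ofReal_integral_le_lintegral ?_ ?_ ?_
  · exact (measurable_of_countable (stepVal fun e : Edge A => w e.1)).comp (measurable_pi_apply 1)
  · intro r
    rcases (r 1).dead_or_live with h | ⟨e, h⟩ <;> rw [h]
    · exact ⟨le_rfl, zero_le_one⟩
    · exact hw e.1
  · intro r
    rcases (r 1).dead_or_live with h | ⟨e, h⟩ <;> rw [h]
    · exact ENNReal.ofReal_zero.le
    · exact hR e.1

lemma sum_pmf_mul_mem_Icc {α : Type*} [Fintype α] (p : PMF α) {w : α → ℝ}
    (hw : ∀ a, w a ∈ Set.Icc (0 : ℝ) 1) : ∑ a, (p a).toReal * w a ∈ Set.Icc (0 : ℝ) 1 := by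
  refine ⟨Finset.sum_nonneg fun a _ => mul_nonneg ENNReal.toReal_nonneg (hw a).1, ?_⟩
  rw [← sum_toReal_pmf p]
  exact Finset.sum_le_sum fun a _ => mul_le_of_le_one_right ENNReal.toReal_nonneg (hw a).2

/-- The mean return probability after one step is at least the mean of the limit values. -/
lemma ofReal_sum_stepMean_le {μ : Measure Ω} [IsProbabilityMeasure μ]
    (hP : ∀ s u s', Measurable fun ω => (P ω s u s').toReal) (π π' : Policy A) (s : S)
    (G : Set S) :
    ENNReal.ofReal (∑ u, (π [] s u).toReal * stepMean μ P (fun s' ω => limVal (P ω) π' G s') s u) ≤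
      ∫⁻ ω, ∫⁻ r, Option.elim (r 1) 0 (fun e => reachProb (full (P ω)) π' e.1 G)
        ∂(runLaw (full (P ω)) π s) ∂μ := by
  have hm : ∀ s', Measurable fun ω => limVal (P ω) π' G s' := measurable_limVal hP π' G
  have hI : ∀ s' ω, limVal (P ω) π' G s' ∈ Set.Icc (0 : ℝ) 1 := fun s' ω =>
    limVal_mem_Icc (P ω) π' G s'
  have hu : ∀ u : A s, Measurable fun ω => ∑ s', (P ω s u s').toReal * limVal (P ω) π' G s' :=
    fun u => Finset.measurable_sum _ fun s' _ => (hP s u s').mul (hm s')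
  have hu' := fun (u : A s) ω => sum_pmf_mul_mem_Icc (P ω s u) fun s' => hI s' ω
  have e : ∑ u, (π [] s u).toReal * stepMean μ P (fun s' ω => limVal (P ω) π' G s') s u =
      ∫ ω, ∑ u, (π [] s u).toReal * ∑ s', (P ω s u s').toReal * limVal (P ω) π' G s' ∂μ := by
    rw [integral_finsetSum _ fun u _ => (integrable_of_mem_Icc (hu u) (hu' u)).const_mul _]
    simp only [integral_const_mul]
    rfl
  rw [e]
  exact ofReal_integral_le_lintegral
    (Finset.measurable_sum _ fun u _ => (hu u).const_mul _)
    (fun ω => sum_pmf_mul_mem_Icc (π [] s) fun u => hu' u ω)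
    fun ω => ofReal_sum_le_lintegral_elim (P ω) π s (fun s' => hI s' ω)
      fun s' => limVal_le_reachProb (P ω) π' G s'

lemma coe_sum_ereal {ι : Type*} (t : Finset ι) (f : ι → ℝ) :
    ((∑ i ∈ t, f i : ℝ) : EReal) = ∑ i ∈ t, (f i : EReal) := by
  classical
  induction t using Finset.induction_on with
  | empty => simp
  | insert i t hi ih => rw [Finset.sum_insert hi, Finset.sum_insert hi, EReal.coe_add, ih]

/-- The value of one step of the mean process, killed on `G₁`, is at most the mean value of one
step. -/
lemma sum_killed_mul_add_le {μ : Measure Ω} [IsProbabilityMeasure μ]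
    {Pm : (s : S) → A s → PMF S} {σ : Edge A → ℝ}
    (hσ : StepBound μ P Pm σ) (hσ0 : ∀ e, σ e ≤ 0) (G₁ : Set S) {W : S → Ω → ℝ}
    (hW : ∀ s', Measurable (W s')) (hW' : ∀ s' ω, W s' ω ∈ Set.Icc (0 : ℝ) 1) {v : S → EReal}
    (hv : ∀ s', v s' ≤ ((∫ ω, W s' ω ∂μ : ℝ) : EReal)) (s : S) (u : A s) :
    (∑ s' : S, ((killed G₁ Pm s u (some s') : ℝ≥0∞) : EReal) * v s') + ((σ ⟨s, u⟩ : ℝ) : EReal) ≤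
      ((stepMean μ P W s u : ℝ) : EReal) := by
  -- If the start is already killed, only `σ ≤ 0` remains on the left, against a non-negative mean.
  by_cases hs : s ∈ G₁
  · simp only [killed_apply_of_mem _ hs, EReal.coe_ennreal_zero, zero_mul, Finset.sum_const_zero,
      zero_add]
    refine EReal.coe_le_coe_iff.2 ((hσ0 _).trans ?_)
    exact integral_nonneg fun ω => (sum_pmf_mul_mem_Icc (P ω s u) fun s' => hW' s' ω).1
  · simp only [killed_apply_of_notMem _ hs]
    refine le_trans ?_ (EReal.coe_le_coe_iff.2 (hσ s u W hW hW'))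
    rw [EReal.coe_add, coe_sum_ereal]
    refine add_le_add_left (Finset.sum_le_sum fun s' _ => ?_) _
    rw [EReal.coe_mul, ← EReal.coe_ennreal_toReal ((Pm s u).apply_ne_top s')]
    -- `v s'` may be `-∞`; monotonicity in `EReal` suffices.
    exact mul_le_mul_of_nonneg_left (hv s') (EReal.coe_nonneg.2 ENNReal.toReal_nonneg)

end Simulation

/-! ### Flow equations and stationary policies -/

section Flow

variable {S : Type*} [Fintype S] {A : S → Type*} [∀ s, Fintype (A s)]

lemma val_eq_of_stationary (T : Trans A) {π : Policy A}
    (hπ : ∀ h h', π h = π h') (f : Edge A → ℝ) (k : ℕ) (h h' : List (Edge A)) (s : S) :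
    val T π f k h s = val T π f k h' s := by
  induction k generalizing h h' s with
  | zero => rfl
  | succ k ih =>
    refine Finset.sum_congr rfl fun u _ => ?_
    rw [hπ h h']
    congr 2
    exact Finset.sum_congr rfl fun s' _ => by rw [ih _ (h' ++ [⟨s, u⟩])]

/-- A solution `y` of the flow equations dominates the occupation measure of the policy derived
from it, up to a part on which the process never leaves: the values of the policy average to at
least the value of `y`. -/
lemma mul_sum_le_sum_val_add (T : Trans A) {π : Policy A} (hπ : ∀ h h', π h = π h')
    {f : Edge A → ℝ} {y : Edge A → ℝ} (hy : ∀ e, 0 ≤ y e)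
    (hyπ : ∀ e, y e = (∑ w, y ⟨e.1, w⟩) * (π [] e.1 e.2).toReal) (s₀ : S)
    (hflow : ∀ g : S → ℝ, ∑ s, (∑ u, y ⟨s, u⟩) * g s =
      g s₀ + ∑ e, y e * ∑ s', (T e.1 e.2 (some s')).toReal * g s')
    (hval : ∀ k s, val T π f k [] s ≤ 1) (N : ℕ) :
    N * ∑ e, y e * f e ≤ ∑ k ∈ Finset.range N, val T π f k [] s₀ + ∑ e, y e := by
  -- With `m s = ∑ u, y ⟨s, u⟩` and `V k` the value, `y = m π` gives `∑ m V (k + 1) = ∑ y (f + T V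
  -- k)`. The flow equations tested against `V k` give `∑ m V k = V k s₀ + ∑ y T V k`. Subtract.
  have hstep : ∀ k, val T π f k [] s₀ = ∑ e, y e * f e +
      ∑ s, (∑ u, y ⟨s, u⟩) * val T π f k [] s -
      ∑ s, (∑ u, y ⟨s, u⟩) * val T π f (k + 1) [] s := by
    intro k
    have h1 : ∑ s, (∑ u, y ⟨s, u⟩) * val T π f (k + 1) [] s =
        ∑ e, y e * (f e + ∑ s', (T e.1 e.2 (some s')).toReal * val T π f k [] s') := by
      rw [Fintype.sum_sigma]
      refine Finset.sum_congr rfl fun s _ => ?_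
      rw [val, Finset.mul_sum]
      refine Finset.sum_congr rfl fun u _ => ?_
      rw [hyπ ⟨s, u⟩, mul_assoc]
      congr 3
      exact Finset.sum_congr rfl fun s' _ => by rw [val_eq_of_stationary T hπ f k _ []]
    rw [h1, hflow (val T π f k [])]
    simp only [mul_add, Finset.sum_add_distrib]
    ring
  have hsum : ∑ k ∈ Finset.range N, val T π f k [] s₀ = N * ∑ e, y e * f e -
      ∑ s, (∑ u, y ⟨s, u⟩) * val T π f N [] s := by
    induction N with
    | zero => simp [val]
    | succ N ih =>
      rw [Finset.sum_range_succ, ih, hstep N]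
      push_cast
      ring
  -- Only an upper bound on the values is needed; they may tend to `-∞` with the horizon.
  have hle : ∑ s, (∑ u, y ⟨s, u⟩) * val T π f N [] s ≤ ∑ e, y e := by
    rw [Fintype.sum_sigma]
    exact Finset.sum_le_sum fun s _ => mul_le_of_le_one_right
      (Finset.sum_nonneg fun u _ => hy _) (hval N s)
  linarith

end Flow

/-- The components of a Dirichlet vector with zero parameter vanish. -/
lemma dirichlet_ae_eq_zero {ι : Type*} [Fintype ι] {α : ι → ℝ≥0} {i : ι} (hi : α i = 0) :
    ∀ᵐ x ∂(dirichlet α), x.1 i = 0 := by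
  have hm : Measurable fun (g : ι → ℝ) i => g i / ∑ j, g j := by fun_prop
  have hs : MeasurableSet (stdSimplex ℝ ι) := (isClosed_stdSimplex ℝ ι).measurableSet
  have h1 : ∀ᵐ g ∂(Measure.pi fun i => gammaZ (α i)), g i = 0 :=
    (Measure.quasiMeasurePreserving_eval (fun i => gammaZ (α i)) i).ae (p := fun x => x = 0) (by
      rw [gammaZ, if_pos hi]
      simp [ae_dirac_eq])
  have hz : MeasurableSet {x : ι → ℝ | x i ≠ 0} :=
    (measurableSet_eq_fun (measurable_pi_apply i) measurable_const).compl
  rw [ae_iff, dirichlet, (MeasurableEmbedding.subtype_coe hs).comap_apply]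
  refine measure_mono_null (t := {x : ι → ℝ | x i ≠ 0}) ?_ ?_
  · rintro _ ⟨x, hx, rfl⟩
    exact hx
  · rw [Measure.map_apply hm hz]
    -- A vanishing coordinate stays zero under normalization, even for total `0`, since then `0 / 0
    -- = 0`.
    refine measure_mono_null (fun g hg => ?_) (ae_iff.1 h1)
    intro h0
    exact hg (by simp [h0])

/-! ### The product under the Dirichlet belief, and the guarantees -/

namespace UncertainMDP

variable {X U AP Q : Type*} [Fintype X] [Fintype Q]

/-- Outside `post` the automaton disagrees, or a zero parameter makes a Dirichlet factor vanish
almost surely. This is why `σ` need only sum over `post`. -/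
lemma pE_ae_eq_zero (M : UncertainMDP X U AP) (R : DRA AP Q) {s : M.State Q} {u : M.Act Q s}
    {s' : M.State Q} (h : s' ∉ M.post R s u) : ∀ᵐ ω ∂M.belief, M.pE R ω s u s' = 0 := by
  have i1 := fun d => isProbabilityMeasure_dirichlet (M.αD_ne_zero d)
  have i2 := fun x => isProbabilityMeasure_dirichlet (M.αL_ne_zero x)
  by_cases hq : s'.2.2 = R.δ s.2.2 s.2.1
  · by_cases hD : M.αD ⟨s.1, u⟩ s'.1 = 0
    · have h1 : ∀ᵐ ω ∂M.belief, (ω.1 ⟨s.1, u⟩).1 s'.1 = 0 :=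
        Measure.quasiMeasurePreserving_fst.ae
          ((Measure.quasiMeasurePreserving_eval (fun d => dirichlet (M.αD d)) ⟨s.1, u⟩).ae
            (dirichlet_ae_eq_zero hD))
      filter_upwards [h1] with ω hω
      simp [pE, hω]
    · have hL : M.αL s'.1 s'.2.1 = 0 := by
        by_contra hL
        exact h ⟨hq, pos_iff_ne_zero.2 hD, pos_iff_ne_zero.2 hL⟩
      have h1 : ∀ᵐ ω ∂M.belief, (ω.2 s'.1).1 s'.2.1 = 0 :=
        Measure.quasiMeasurePreserving_snd.ae
          ((Measure.quasiMeasurePreserving_eval (fun x => dirichlet (M.αL x)) s'.1).ae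
            (dirichlet_ae_eq_zero hL))
      filter_upwards [h1] with ω hω
      simp [pE, hω]
  · exact .of_forall fun ω => by simp [pE, hq]

lemma meanPE_eq_zero (M : UncertainMDP X U AP) (R : DRA AP Q) {s : M.State Q} {u : M.Act Q s}
    {s' : M.State Q} (h : s' ∉ M.post R s u) : M.meanPE R s u s' = 0 :=
  integral_eq_zero_of_ae (M.pE_ae_eq_zero R h)

lemma prod_toReal (M : UncertainMDP X U AP) (R : DRA AP Q) (ω : M.Sample) (s : M.State Q)
    (u : M.Act Q s) (s' : M.State Q) : (M.prod R ω s u s').toReal = M.pE R ω s u s' :=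
  ENNReal.toReal_ofReal (M.pE_nonneg R ω s u s')

lemma mean_toReal (M : UncertainMDP X U AP) (R : DRA AP Q) (s : M.State Q)
    (u : M.Act Q s) (s' : M.State Q) : (M.mean R s u s').toReal = M.meanPE R s u s' :=
  ENNReal.toReal_ofReal (integral_nonneg fun ω => M.pE_nonneg R ω s u s')

lemma measurable_prod_toReal (M : UncertainMDP X U AP) (R : DRA AP Q) (s : M.State Q)
    (u : M.Act Q s) (s' : M.State Q) : Measurable fun ω => (M.prod R ω s u s').toReal := by
  simp only [prod_toReal]
  exact M.measurable_pE R s u s'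

lemma integrable_min_pE (M : UncertainMDP X U AP) (R : DRA AP Q) (s : M.State Q)
    (u : M.Act Q s) (s' : M.State Q) :
    Integrable (fun ω => min 0 (M.pE R ω s u s' - M.meanPE R s u s')) M.belief :=
  (integrable_const 0).inf ((M.integrable_pE R s u s').sub (integrable_const _))

lemma sigma_nonpos (M : UncertainMDP X U AP) (R : DRA AP Q) (e : Edge (M.Act Q)) :
    M.sigma R e ≤ 0 :=
  Finset.sum_nonpos fun _ _ => integral_nonpos fun _ => min_le_left _ _

/-- The correction term bounds the loss in one step of replacing a sample by the mean. -/
lemma stepBound_sigma (M : UncertainMDP X U AP) (R : DRA AP Q) :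
    StepBound M.belief (fun ω => M.prod R ω) (M.mean R) (M.sigma R) := by
  classical
  intro s u W hW hW'
  have hWi : ∀ s', Integrable (W s') M.belief := fun s' => integrable_of_mem_Icc (hW s') (hW' s')
  have hpi : ∀ s', Integrable (fun ω => M.pE R ω s u s' * W s' ω) M.belief := fun s' =>
    integrable_of_mem_Icc ((M.measurable_pE R s u s').mul (hW s')) fun ω =>
      ⟨mul_nonneg (M.pE_nonneg R ω s u s') (hW' s' ω).1,
        mul_le_one₀ (M.pE_le_one R ω s u s') (hW' s' ω).1 (hW' s' ω).2⟩
  simp only [prod_toReal, mean_toReal]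
  rw [integral_finsetSum _ fun s' _ => hpi s', sigma, Finset.sum_filter, ← Finset.sum_add_distrib]
  refine Finset.sum_le_sum fun s' _ => ?_
  -- On `post`, `p W ≥ p̄ W + min (0, p - p̄)` pointwise, by the sign of `p - p̄` and `0 ≤ W ≤ 1`.
  -- Elsewhere `p̄ = 0` and no correction is due.
  split_ifs with h
  · rw [← integral_const_mul, ← integral_add ((hWi s').const_mul _) (M.integrable_min_pE R s u s')]
    refine integral_mono (((hWi s').const_mul _).add (M.integrable_min_pE R s u s')) (hpi s')
      fun ω => ?_
    obtain ⟨h0, h1⟩ := hW' s' ω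
    rcases le_total 0 (M.pE R ω s u s' - M.meanPE R s u s') with hp | hp
    · simp only [min_eq_left hp]
      nlinarith
    · simp only [min_eq_right hp]
      nlinarith
  · rw [M.meanPE_eq_zero R h, zero_mul, add_zero]
    exact integral_nonneg fun ω => mul_nonneg (M.pE_nonneg R ω s u s') (hW' s' ω).1

/-- `satTerm` charges `σ` on the target too, which only lowers it because `σ ≤ 0`. -/
lemma satTerm_le (M : UncertainMDP X U AP) (R : DRA AP Q) (e : Edge (M.Act Q)) :
    M.satTerm R e ≤ ind (M.accSet R) e + (1 - ind (M.accSet R) e) * M.sigma R e := by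
  have h := M.sigma_nonpos R e
  unfold satTerm ind
  split_ifs <;> linarith

lemma ofReal_val_le_expReach (M : UncertainMDP X U AP) (R : DRA AP Q) (πo : Policy (M.Act Q))
    (k : ℕ) :
    ENNReal.ofReal (val (M.mean₁ R) πo (M.satTerm R) k [] (M.start R)) ≤ M.expReach R πo :=
  val_le_lintegral_reachProb (M.measurable_prod_toReal R) (M.stepBound_sigma R) πo (M.accSet R)
    (M.satTerm_le R) k (M.start R)

lemma expReach_le_one (M : UncertainMDP X U AP) (R : DRA AP Q) (πo : Policy (M.Act Q)) :
    M.expReach R πo ≤ 1 :=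
  (lintegral_mono fun _ => reachProb_le_one _ _ _ _).trans (by simp)

lemma val_le_toReal_expReach (M : UncertainMDP X U AP) (R : DRA AP Q) (πo : Policy (M.Act Q))
    (k : ℕ) :
    val (M.mean₁ R) πo (M.satTerm R) k [] (M.start R) ≤ (M.expReach R πo).toReal :=
  (ENNReal.ofReal_le_iff_le_toReal
    ((M.expReach_le_one R πo).trans_lt ENNReal.one_lt_top).ne).1 (M.ofReal_val_le_expReach R πo k)

lemma returnValue_le (M : UncertainMDP X U AP) (R : DRA AP Q) (Xr : Set X)
    (πr : Policy (M.Act Q)) (s : M.State Q) :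
    M.returnValue R Xr πr s ≤
      ((∫ ω, limVal (M.prod R ω) πr (M.homeSet Q Xr) s ∂M.belief : ℝ) : EReal) :=
  expTotal_le_integral_limVal (M.measurable_prod_toReal R) (M.stepBound_sigma R) πr
    (M.homeSet Q Xr) (fun _ => le_rfl) s

/-- The mean return probability after the action `u` at the initial state. -/
def stepReturn (M : UncertainMDP X U AP) (R : DRA AP Q) (Xr : Set X) (πr : Policy (M.Act Q))
    (u : M.Act Q (M.start R)) : ℝ :=
  stepMean M.belief (fun ω => M.prod R ω)
    (fun s' ω => limVal (M.prod R ω) πr (M.homeSet Q Xr) s') (M.start R) u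

lemma ofReal_sum_stepReturn_le (M : UncertainMDP X U AP) (R : DRA AP Q) (Xr : Set X)
    (πo πr : Policy (M.Act Q)) :
    ENNReal.ofReal (∑ u, (πo [] (M.start R) u).toReal * M.stepReturn R Xr πr u) ≤
      M.expSafe R Xr πo πr :=
  ofReal_sum_stepMean_le (M.measurable_prod_toReal R) πo πr (M.start R) (M.homeSet Q Xr)

lemma first_step_le_stepReturn (M : UncertainMDP X U AP) (R : DRA AP Q) (Xr : Set X)
    (πr : Policy (M.Act Q)) (u : M.Act Q (M.start R)) :
    (∑ s', ((M.mean₁ R (M.start R) u (some s') : ℝ≥0∞) : EReal) * M.returnValue R Xr πr s') +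
      ((M.sigma R ⟨M.start R, u⟩ : ℝ) : EReal) ≤ ((M.stepReturn R Xr πr u : ℝ) : EReal) :=
  sum_killed_mul_add_le (M.stepBound_sigma R) (M.sigma_nonpos R) (M.accSet R)
    (measurable_limVal (M.measurable_prod_toReal R) πr (M.homeSet Q Xr))
    (fun s' ω => limVal_mem_Icc (M.prod R ω) πr (M.homeSet Q Xr) s')
    (M.returnValue_le R Xr πr) (M.start R) u

/-- A bound from every state, as the flow argument weighs states that the start may never reach. -/
lemma val_satTerm_le_one (M : UncertainMDP X U AP) (R : DRA AP Q) (πo : Policy (M.Act Q)) (k : ℕ)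
    (s : M.State Q) : val (M.mean₁ R) πo (M.satTerm R) k [] s ≤ 1 := by
  refine (val_le_integral_val (M.measurable_prod_toReal R) (M.stepBound_sigma R) πo (M.accSet R)
    (M.satTerm_le R) k [] s).trans ?_
  refine (integral_mono (integrable_of_mem_Icc
    (measurable_val_killed (M.measurable_prod_toReal R) πo _ k [] s)
    fun ω => val_killed_mem_Icc (M.prod R ω) πo _ k [] s) (integrable_const 1)
    fun ω => (val_killed_mem_Icc (M.prod R ω) πo _ k [] s).2).trans ?_
  simp

/-- The guarantees hold for every feasible point of the prefix problem. -/
lemma PrefixFeasible.guarantees {M : UncertainMDP X U AP} {R : DRA AP Q} {Xr : Set X}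
    {χo χr : ℝ} {πo πr : Policy (M.Act Q)} (h : M.PrefixFeasible R Xr χo χr πo πr) :
    ENNReal.ofReal χo ≤ M.expReach R πo ∧ ENNReal.ofReal χr ≤ M.expSafe R Xr πo πr := by
  obtain ⟨h1, h2⟩ := h
  constructor
  · refine ENNReal.ofReal_le_of_le_toReal (EReal.coe_le_coe_iff.1 (h1.trans ?_))
    exact expTotal_le _ _ _ _ (M.val_le_toReal_expReach R πo)
  · refine (ENNReal.ofReal_le_ofReal (EReal.coe_le_coe_iff.1 (h2.trans ?_))).trans
      (M.ofReal_sum_stepReturn_le R Xr πo πr)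
    rw [coe_sum_ereal]
    refine Finset.sum_le_sum fun u _ => ?_
    rw [EReal.coe_mul, ← EReal.coe_ennreal_toReal ((πo [] _).apply_ne_top u)]
    exact mul_le_mul_of_nonneg_left (M.first_step_le_stepReturn R Xr πr u)
      (EReal.coe_nonneg.2 ENNReal.toReal_nonneg)

/-- Weak form of flow balance, ready to be tested against value functions. -/
lemma LPFeasible.flow_integrated {M : UncertainMDP X U AP} {R : DRA AP Q} {χo χr : ℝ}
    {v : M.State Q → EReal} {y : Edge (M.Act Q) → ℝ} (h : M.LPFeasible R χo χr v y)
    (g : M.State Q → ℝ) :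
    ∑ s, (∑ u, y ⟨s, u⟩) * g s = g (M.start R) +
      ∑ e : Edge (M.Act Q), y e * ∑ s', (M.mean₁ R e.1 e.2 (some s')).toReal * g s' := by
  classical
  simp only [h.flow, add_mul, Finset.sum_add_distrib, ite_mul, one_mul, zero_mul,
    Finset.sum_ite_eq', Finset.mem_univ, if_true]
  congr 1
  simp only [Finset.sum_mul, Finset.mul_sum]
  rw [Finset.sum_comm]
  exact Finset.sum_congr rfl fun e _ => Finset.sum_congr rfl fun s' _ => mul_assoc _ _ _

/-- Where the total mass is zero the policy is arbitrary, but there all `y` vanish by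
non-negativity. -/
lemma IsDerivedFrom.eq_mul {M : UncertainMDP X U AP} {y : Edge (M.Act Q) → ℝ}
    {π : Policy (M.Act Q)} (h : M.IsDerivedFrom y π) (hy : ∀ e, 0 ≤ y e) (e : Edge (M.Act Q)) :
    y e = (∑ w, y ⟨e.1, w⟩) * (π [] e.1 e.2).toReal := by
  obtain ⟨s, u⟩ := e
  rcases (Finset.sum_nonneg fun w (_ : w ∈ Finset.univ) => hy ⟨s, w⟩).eq_or_lt with h0 | h0
  · rw [← h0, zero_mul]
    exact (Finset.sum_eq_zero_iff_of_nonneg fun w _ => hy ⟨s, w⟩).1 h0.symm u (Finset.mem_univ u)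
  · rw [h.2 [] s h0 u, mul_div_cancel₀ _ h0.ne']

/-- The guarantees hold for the policies derived from feasible points of the linear program. -/
lemma LPFeasible.guarantees {M : UncertainMDP X U AP} {R : DRA AP Q} {Xr : Set X} {χo χr : ℝ}
    {πo πr : Policy (M.Act Q)} {y : Edge (M.Act Q) → ℝ}
    (h : M.LPFeasible R χo χr (M.returnValue R Xr πr) y) (hd : M.IsDerivedFrom y πo) :
    ENNReal.ofReal χo ≤ M.expReach R πo ∧ ENNReal.ofReal χr ≤ M.expSafe R Xr πo πr := by
  have hyπ := hd.eq_mul h.nonneg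
  constructor
  · refine ENNReal.ofReal_le_of_le_toReal ?_
    -- A positive gap would grow linearly in `N` against a fixed bound.
    have key : ∀ N : ℕ, (N : ℝ) * (χo - (M.expReach R πo).toReal) ≤ ∑ e, y e := by
      intro N
      have h1 := mul_sum_le_sum_val_add (M.mean₁ R) hd.1 (f := M.satTerm R) h.nonneg hyπ
        (M.start R) h.flow_integrated (M.val_satTerm_le_one R πo) N
      have h2 : ∑ k ∈ Finset.range N, val (M.mean₁ R) πo (M.satTerm R) k [] (M.start R) ≤
          N * (M.expReach R πo).toReal := by
        refine (Finset.sum_le_sum fun k _ => M.val_le_toReal_expReach R πo k).trans ?_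
        simp
      have h3 := mul_le_mul_of_nonneg_left h.sat (Nat.cast_nonneg (α := ℝ) N)
      linarith
    by_contra! hlt
    obtain ⟨N, hN⟩ := exists_nat_gt ((∑ e, y e) / (χo - (M.expReach R πo).toReal))
    have := (div_lt_iff₀ (sub_pos.2 hlt)).1 hN
    exact absurd (key N) (not_le.2 this)
  · refine (ENNReal.ofReal_le_ofReal ?_).trans (M.ofReal_sum_stepReturn_le R Xr πo πr)
    -- The unit source makes the mass at the start at least `1`, so the homogeneous safety
    -- constraint can be divided by it.
    have hpos : 0 < ∑ u, y ⟨M.start R, u⟩ := by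
      rw [h.flow, if_pos rfl]
      have := Finset.sum_nonneg fun e (_ : e ∈ (Finset.univ : Finset (Edge (M.Act Q)))) =>
        mul_nonneg (h.nonneg e)
          (ENNReal.toReal_nonneg (a := M.mean₁ R e.1 e.2 (some (M.start R))))
      linarith
    have h1 : χr * ∑ u, y ⟨M.start R, u⟩ ≤
        ∑ u, y ⟨M.start R, u⟩ * M.stepReturn R Xr πr u := by
      refine EReal.coe_le_coe_iff.1 (h.safe.trans ?_)
      rw [coe_sum_ereal]
      refine Finset.sum_le_sum fun u _ => ?_
      rw [EReal.coe_mul]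
      exact mul_le_mul_of_nonneg_left (M.first_step_le_stepReturn R Xr πr u)
        (EReal.coe_nonneg.2 (h.nonneg _))
    refine le_of_mul_le_mul_left ?_ hpos
    rw [mul_comm _ χr, Finset.mul_sum _ _ (∑ u, y ⟨M.start R, u⟩)]
    refine h1.trans (Finset.sum_le_sum fun u _ => le_of_eq ?_)
    rw [hyπ ⟨M.start R, u⟩, mul_assoc]

end UncertainMDP

end SafePlan

end

theorem lemma1 {X U AP Q : Type*} [Fintype X] [Fintype Q]
    (M : SafePlan.UncertainMDP X U AP) (R : SafePlan.DRA AP Q) (Xr : Set X)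
    (gU gL aU aL χo χr : ℝ) (hgU : 0 < gU) (hgL : 0 < gL) (haU : 0 < aU) (haL : 0 < aL)
    (hχo : 0 < χo) (hχr : 0 < χr) :
    -- the optimal solutions of the constrained problem
    (∀ πo πr : SafePlan.Policy (M.Act Q),
      M.PrefixOptimal R Xr gU gL aU aL χo χr πo πr →
        ENNReal.ofReal χo ≤ M.expReach R πo ∧ ENNReal.ofReal χr ≤ M.expSafe R Xr πo πr) ∧
    -- the policies obtained from its linear program, given the return values
    (∀ (πo πr : SafePlan.Policy (M.Act Q)) (y : SafePlan.Edge (M.Act Q) → ℝ),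
      M.LPOptimal R gU gL aU aL χo χr (M.returnValue R Xr πr) y →
      M.IsDerivedFrom y πo →
        ENNReal.ofReal χo ≤ M.expReach R πo ∧ ENNReal.ofReal χr ≤ M.expSafe R Xr πo πr) := by
  exact ⟨fun _ _ h => h.1.guarantees, fun _ _ _ h hd => h.1.guarantees hd⟩
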